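/- Let $k$ be a commutative domain; algebras are associative unital $k$-algebras, $\otimes=\otimes_k$, and isomorphisms are $k$-algebra isomorphisms. **Definitions.** An $\mathbb N$-filtration of an algebra $T$ is an exhaustive increasing sequence of $k$-submodules $F_0T\subseteq F_1T\subseteq\cdots$ with $1\in F_0T$ and $F_iT\,F_jT\subseteq F_{i+j}T$; $\operatorname{gr}T=\bigoplus_i F_iT/F_{i-1}T$ (with $F_{-1}T=0$), and $\deg a=\min\{i: a\in F_iT\}$ for $a\ne 0$. A graded algebra is connected if its degree-$0$ part is $k$. $\operatorname{GKdim}A=\sup_V\limsup_n\log_n\operatorname{rank}_k(V^n)$, over finitely generated $k$-submodules $V\subseteq A$, where $\operatorname{rank}_kM=\dim_{\operatorname{Frac}k}(M\otimes \operatorname{Frac}k)$. *Discriminant.* Let $A$ be a PI domain with center $C$ and regular trace $\operatorname{tr}:A\to Q(C)$ (the trace of left multiplication on $A\otimes_C Q(C)$, $Q(C)$ the field of fractions of $C$), and let $w\ge 1$. An element $x$ is normal if $xA=Ax$; a normal $x$ is a common divisor of $D\subseteq A$ if $D\subseteq Ax$, and a gcd of $D$ if moreover $x\in Ay$ for every common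 divisor $y$ of $D$. If $\operatorname{tr}(A)\subseteq C$, a $w$-discriminant of $A$ over $C$ is a gcd in $A$ of all $\det(\operatorname{tr}(z_iz'_j))_{w\times w}$ with $z_1,\dots,z_w,z'_1,\dots,z'_w\in A$. *Effective and dominating elements.* Let $k\subseteq A$, and let $Y=\bigoplus_{i=1}^n kx_i\subseteq A$ be a free $k$-submodule with $k1_A\cap Y=0$ that generates $A$ as an algebra. A presentation of $f\in A$ is a $p\in k\langle X_1,\dots,X_n\rangle$ with $p(x_1,\dots,x_n)=f$. - $f$ is *effective* if, for some such $Y,x_1,\dots,x_n$ and some $\mathbb N$-filtration of $A$ with $\operatorname{gr}A$ a domain, the following holds: for every $\mathbb N$-filtered PI algebra $T$ with $\operatorname{gr}T$ a domain, and all $y_1,\dots,y_n\in T$ that are linearly independent in $T/k1_T$ and satisfy $\deg y_i\ge\deg x_i$ for all $i$ and $\deg y_{i_0}>\deg x_{i_0}$ for some $i_0$, there is a presentation $p$ of $f$ such that $p(y_1,\dots,y_n)=0$ or $\deg p(y_1,\dots,y_n)>\deg f$. - $f$ is *dominating* if, for some such $Y,x_1,\dots,x_n$ for which the filtration $F_iA=(k1_A+Y)^i$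 has $\operatorname{gr}A$ a connected graded domain, the following holds: for every $\mathbb N$-filtered PI algebra $T$ with $\operatorname{gr}T$ a connected graded domain, and all $y_1,\dots,y_n\in T$ that are linearly independent in $T/F_0T$, there is a presentation $p$ of $f$ such that either $p(y_1,\dots,y_n)=0$, or $\deg p(y_1,\dots,y_n)\ge\deg f$, with strict inequality if $\deg y_{i_0}>1$ for some $i_0$. *Rigidity and cancellation.* A higher derivation of $A$ is a sequence $\partial=(\partial_i)_{i\ge0}$ of $k$-linear endomorphisms with $\partial_0=\mathrm{id}$ and $\partial_n(ab)=\sum_{i=0}^n\partial_i(a)\partial_{n-i}(b)$. It is locally nilpotent if for each $a$ one has $\partial_i(a)=0$ for $i\gg0$, and the map $A[t]\to A[t]$, $a\mapsto\sum_i\partial_i(a)t^i$, $t\mapsto t$, is an algebra automorphism. $\mathrm{ML}^H(A)$ is the intersection of $\bigcap_{i\ge1}\ker\partial_i$ over all locally nilpotent higher derivations $\partial$ of $A$. $A$ is *strongly $\mathrm{LND}^H$-rigid* if $\mathrm{ML}^H(A[t_1,\dots,t_d])=A$ for all $d\ge1$, and *strongly cancellative* if for all $d\ge1$ and all algebras $B$,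 $A[t_1,\dots,t_d]\cong B[t_1,\dots,t_d]$ implies $A\cong B$. **Theorem.** Let $A$ be a PI domain that has, for some $w\ge1$, a nonzero $w$-discriminant $f$ over its center. (1) Suppose that $f$ is effective and $\operatorname{GKdim}A<\infty$. Let $R$ be a finitely generated commutative algebra that is a domain, free as a $k$-module and connected $\mathbb N$-graded, such that $A\otimes R$ is a domain. If $A\otimes R\cong B\otimes R$ for some algebra $B$, then $A\cong B$. As a consequence, $A$ is strongly cancellative. (2) If $f$ is effective or dominating, then $A$ is strongly $\mathrm{LND}^H$-rigid. -/

import Mathlib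

open scoped TensorProduct DirectSum Polynomial

universe u₁ u₂ u₃ u₄

noncomputable section

/-! ### PI algebras -/

/-- `A` is a PI algebra over `k`: it satisfies a monic polynomial identity, that is, some
noncommutative polynomial `p` with coefficients in `k`, one of whose monomials of highest degree
has coefficient `1`, vanishes under every substitution of elements of `A` for the variables. -/
def IsPI (k : Type*) (A : Type*) [CommRing k] [Ring A] [Algebra k A] : Prop :=
  ∃ p : FreeAlgebra k ℕ,
    (∃ m : FreeMonoid ℕ,
      (FreeAlgebra.equivMonoidAlgebraFreeMonoid p).coeff m = 1 ∧
      ∀ m' ∈ (FreeAlgebra.equivMonoidAlgebraFreeMonoid p).coeff.support,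
        m'.length ≤ m.length) ∧
    ∀ a : ℕ → A, FreeAlgebra.lift k a p = 0

/-! ### Gelfand-Kirillov dimension -/

/-- The rank of a `k`-module `M` over a domain `k`: the dimension of `Frac(k) ⊗ M`. -/
def fracRank (k : Type*) (M : Type*) [CommRing k] [IsDomain k] [AddCommGroup M] [Module k M] : ℕ :=
  Module.finrank (FractionRing k) (FractionRing k ⊗[k] M)

/-- The GK-dimension over a commutative domain `k`:
`sup_V limsup_n log_n rank_k(V^n)`, where `V` runs over the finitely generated `k`-submodules. -/
def gkDim (k : Type*) (A : Type*) [CommRing k] [IsDomain k] [Ring A] [Algebra k A] : EReal :=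
  ⨆ V : {V : Submodule k A // V.FG},
    Filter.limsup
      (fun n : ℕ => ((Real.logb (n : ℝ) (fracRank k ↥(V.1 ^ n) : ℝ) : ℝ) : EReal)) Filter.atTop

/-! ### Filtrations and associated graded rings -/

/-- An (exhaustive) `ℕ`-filtration `F_0 ⊆ F_1 ⊆ ⋯` of a `k`-algebra by `k`-submodules. -/
structure NatFiltration (k : Type*) (A : Type*) [CommRing k] [Ring A] [Algebra k A] where
  /-- the pieces of the filtration -/
  piece : ℕ → Submodule k A
  mono : Monotone piece
  one_mem : (1 : A) ∈ piece 0
  mul_mem : ∀ {i j : ℕ} {a b : A}, a ∈ piece i → b ∈ piece j → a * b ∈ piece (i + j)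
  exhaustive : ∀ a : A, ∃ i, a ∈ piece i

namespace NatFiltration

variable {k : Type*} {A : Type*} [CommRing k] [Ring A] [Algebra k A] (F : NatFiltration k A)

/-- The degree of `a`: the least `i` with `a ∈ F_i`. (The degree of `0` is never used.) -/
def deg (a : A) : ℕ := sInf {i | a ∈ F.piece i}

/-- `F_{i-1}`, with `F_{-1} = 0`. -/
def prev : ℕ → Submodule k A
  | 0 => ⊥
  | i + 1 => F.piece i

/-- The component `F_i / F_{i-1}` of the associated graded ring. -/
abbrev grPiece (i : ℕ) : Type _ := ↥(F.piece i) ⧸ (F.prev i).submoduleOf (F.piece i)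

variable {F} in
/-- The class in `F_i / F_{i-1}` of an element of `F_i`. -/
def symb {i : ℕ} (a : A) (ha : a ∈ F.piece i) : F.grPiece i :=
  Submodule.Quotient.mk ⟨a, ha⟩

theorem mul_mem_prev_left {i j : ℕ} {a b : A} (ha : a ∈ F.prev i) (hb : b ∈ F.piece j) :
    a * b ∈ F.prev (i + j) := by
  cases i with
  | zero =>
    have h : a = 0 := ha
    rw [h, zero_mul]
    exact Submodule.zero_mem _
  | succ i =>
    rw [Nat.succ_add]
    exact F.mul_mem ha hb

theorem mul_mem_prev_right {i j : ℕ} {a b : A} (ha : a ∈ F.piece i) (hb : b ∈ F.prev j) :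
    a * b ∈ F.prev (i + j) := by
  cases j with
  | zero =>
    have h : b = 0 := hb
    rw [h, mul_zero]
    exact Submodule.zero_mem _
  | succ j => exact F.mul_mem ha hb

/-- The product `F_i × F_j → F_{i+j} / F_{i+j-1}`, as a bilinear map. -/
def preMul (i j : ℕ) : ↥(F.piece i) →ₗ[k] ↥(F.piece j) →ₗ[k] F.grPiece (i + j) :=
  LinearMap.mk₂ k (fun a b => symb (a.1 * b.1) (F.mul_mem a.2 b.2))
    (fun a a' b => congrArg Submodule.Quotient.mk (Subtype.ext (add_mul a.1 a'.1 b.1)))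
    (fun c a b => congrArg Submodule.Quotient.mk (Subtype.ext (smul_mul_assoc c a.1 b.1)))
    (fun a b b' => congrArg Submodule.Quotient.mk (Subtype.ext (mul_add a.1 b.1 b'.1)))
    (fun c a b => congrArg Submodule.Quotient.mk (Subtype.ext (mul_smul_comm c a.1 b.1)))

/-- The product `F_i / F_{i-1} × F_j / F_{j-1} → F_{i+j} / F_{i+j-1}`. -/
def grMul (i j : ℕ) : F.grPiece i →ₗ[k] F.grPiece j →ₗ[k] F.grPiece (i + j) :=
  Submodule.liftQ _
    (LinearMap.flip (Submodule.liftQ _ (LinearMap.flip (F.preMul i j)) (by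
      intro b hb
      ext a
      exact (Submodule.Quotient.mk_eq_zero _).2 (F.mul_mem_prev_right a.2 hb))))
    (by
      intro a ha
      ext b
      exact (Submodule.Quotient.mk_eq_zero _).2 (F.mul_mem_prev_left ha b.2))

theorem grMul_symb {i j : ℕ} {a b : A} (ha : a ∈ F.piece i) (hb : b ∈ F.piece j) :
    F.grMul i j (symb a ha) (symb b hb) = symb (a * b) (F.mul_mem ha hb) := rfl

theorem mk_symb_congr {i j : ℕ} (h : i = j) {a b : A} (hab : a = b) (ha : a ∈ F.piece i)
    (hb : b ∈ F.piece j) :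
    (GradedMonoid.mk i (symb a ha) : GradedMonoid F.grPiece) = GradedMonoid.mk j (symb b hb) := by
  subst h
  subst hab
  rfl

theorem exists_symb (x : GradedMonoid F.grPiece) :
    ∃ (i : ℕ) (a : A) (ha : a ∈ F.piece i), x = GradedMonoid.mk i (symb a ha) := by
  obtain ⟨i, x⟩ := x
  obtain ⟨a, rfl⟩ := Submodule.Quotient.mk_surjective _ x
  exact ⟨i, a.1, a.2, rfl⟩

instance grGMul : GradedMonoid.GMul F.grPiece where
  mul {i j} a b := F.grMul i j a b

instance grGOne : GradedMonoid.GOne F.grPiece where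
  one := symb 1 F.one_mem

instance grGMonoid : GradedMonoid.GMonoid F.grPiece where
  one_mul x := by
    obtain ⟨i, a, ha, rfl⟩ := F.exists_symb x
    exact F.mk_symb_congr (zero_add i) (one_mul a) _ _
  mul_one x := by
    obtain ⟨i, a, ha, rfl⟩ := F.exists_symb x
    exact F.mk_symb_congr (add_zero i) (mul_one a) _ _
  mul_assoc x y z := by
    obtain ⟨i, a, ha, rfl⟩ := F.exists_symb x
    obtain ⟨j, b, hb, rfl⟩ := F.exists_symb y
    obtain ⟨l, c, hc, rfl⟩ := F.exists_symb z
    exact F.mk_symb_congr (add_assoc i j l) (mul_assoc a b c) _ _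

instance grGSemiring : DirectSum.GSemiring F.grPiece where
  mul_zero {i j} a := map_zero (F.grMul i j a)
  zero_mul {i j} b := LinearMap.map_zero₂ (F.grMul i j) b
  mul_add {i j} a b c := map_add (F.grMul i j a) b c
  add_mul {i j} a b c := LinearMap.map_add₂ (F.grMul i j) a b c
  natCast n := n • symb 1 F.one_mem
  natCast_zero := zero_smul _ _
  natCast_succ _ := succ_nsmul _ _

/-- The associated graded ring `gr A = ⨁ F_i / F_{i-1}`. -/
abbrev gr : Type _ := ⨁ i, F.grPiece i

/-- `gr A` is connected graded: its degree zero part `F_0` is `k` (more precisely, `k → F_0` is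
bijective). -/
def IsConnected : Prop :=
  Function.Injective (algebraMap k A) ∧ F.piece 0 = 1

end NatFiltration

/-! ### Generators, effective and dominating elements -/

/-- `k ⊆ A`, and `Y = ⨁ k x_i` is a free `k`-submodule of `A` with basis `x_1, …, x_n` that
satisfies `k 1 ∩ Y = 0` and generates `A` as an algebra. -/
structure IsFreeGeneratingSet (k : Type*) {A : Type*} [CommRing k] [Ring A] [Algebra k A]
    {n : ℕ} (x : Fin n → A) : Prop where
  injective : Function.Injective (algebraMap k A)
  linearIndependent : LinearIndependent k x
  disjoint : Disjoint (1 : Submodule k A) (Submodule.span k (Set.range x))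
  adjoin_eq_top : Algebra.adjoin k (Set.range x) = ⊤

/-- Effective elements. A presentation of `f` is an element `p` of the free algebra
`k⟨x_1, …, x_n⟩` that maps to `f`; it may depend on the test algebra `T` and on the test elements
`y_i`.

Replacing `T` by its subalgebra generated by the `y_i` one sees that it does not matter in
which universe the test algebras live. -/
def IsEffective (k : Type u₁) {A : Type u₂} [CommRing k] [Ring A] [Algebra k A] (f : A) : Prop :=
  ∃ (n : ℕ) (x : Fin n → A), IsFreeGeneratingSet k x ∧
    ∃ F : NatFiltration k A, IsDomain F.gr ∧
      ∀ (T : Type u₂) [Ring T] [Algebra k T] (FT : NatFiltration k T),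
        IsPI k T → IsDomain FT.gr →
        ∀ y : Fin n → T,
          LinearIndependent k (fun i => (Submodule.Quotient.mk (y i) : T ⧸ (1 : Submodule k T))) →
          (∀ i, F.deg (x i) ≤ FT.deg (y i)) →
          (∃ i, F.deg (x i) < FT.deg (y i)) →
          ∃ p : FreeAlgebra k (Fin n), FreeAlgebra.lift k x p = f ∧
            (FreeAlgebra.lift k y p = 0 ∨ F.deg f < FT.deg (FreeAlgebra.lift k y p))

/-- Dominating elements. Here the filtration on `A` is the standard one, `F_i = (k 1 + Y)^i`. -/
def IsDominating (k : Type u₁) {A : Type u₂} [CommRing k] [Ring A] [Algebra k A] (f : A) : Prop :=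
  ∃ (n : ℕ) (x : Fin n → A), IsFreeGeneratingSet k x ∧
    ∃ F : NatFiltration k A,
      (∀ i, F.piece i = ((1 : Submodule k A) ⊔ Submodule.span k (Set.range x)) ^ i) ∧
      F.IsConnected ∧ IsDomain F.gr ∧
      ∀ (T : Type u₂) [Ring T] [Algebra k T] (FT : NatFiltration k T),
        IsPI k T → FT.IsConnected → IsDomain FT.gr →
        ∀ y : Fin n → T,
          LinearIndependent k (fun i => (Submodule.Quotient.mk (y i) : T ⧸ FT.piece 0)) →
          ∃ p : FreeAlgebra k (Fin n), FreeAlgebra.lift k x p = f ∧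
            (FreeAlgebra.lift k y p = 0 ∨
              (F.deg f ≤ FT.deg (FreeAlgebra.lift k y p) ∧
                ((∃ i, 1 < FT.deg (y i)) → F.deg f < FT.deg (FreeAlgebra.lift k y p))))

/-! ### Discriminants over the center -/

/-- The regular trace of `A` over its center `C`, with values in the field of fractions `Q(C)`:
the trace of left multiplication by `a` on `Q(C) ⊗_C A`. -/
def regularTrace (A : Type*) [Ring A] [IsDomain A] (a : A) :
    FractionRing (Subring.center A) :=
  LinearMap.trace (FractionRing (Subring.center A))
    (FractionRing (Subring.center A) ⊗[Subring.center A] A)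
    ((LinearMap.mulLeft (Subring.center A) a).baseChange (FractionRing (Subring.center A)))

/-- A normal element: `x A = A x`. -/
def IsNormalElement {A : Type*} [Ring A] (x : A) : Prop :=
  (∀ a, ∃ b, x * a = b * x) ∧ (∀ a, ∃ b, a * x = x * b)

/-- A normal element `x` is a common divisor of `D` if every `d ∈ D` is of the form `d' x`. -/
def IsCommonDivisor {A : Type*} [Ring A] (D : Set A) (x : A) : Prop :=
  IsNormalElement x ∧ ∀ d ∈ D, ∃ d', d = d' * x

/-- `x` is a greatest common divisor of `D`. -/
def IsGreatestCommonDivisor {A : Type*} [Ring A] (D : Set A) (x : A) : Prop :=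
  IsCommonDivisor D x ∧ ∀ y, IsCommonDivisor D y → ∃ c, x = c * y

/-- `f` is a `w`-discriminant `d_w(A/C)` of `A` over its center `C`: the regular trace `tr` has
values in `C`, and `f` is a gcd in `A` of all the elements `det (tr (z_i z'_j))_{w × w}`. -/
def IsDiscriminant {A : Type*} [Ring A] [IsDomain A] (w : ℕ) (f : A) : Prop :=
  ∃ tr : A → Subring.center A,
    (∀ a, algebraMap (Subring.center A) (FractionRing (Subring.center A)) (tr a)
      = regularTrace A a) ∧
    IsGreatestCommonDivisor
      {d : A | ∃ z z' : Fin w → A,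
        d = ((Matrix.of fun i j => tr (z i * z' j)).det : Subring.center A)} f

/-! ### Locally nilpotent higher derivations -/

/-- A higher derivation of the `k`-algebra `A`. -/
structure IsHigherDerivation {k : Type*} {A : Type*} [CommRing k] [Ring A] [Algebra k A]
    (δ : ℕ → A →ₗ[k] A) : Prop where
  zero_eq : δ 0 = LinearMap.id
  leibniz : ∀ (n : ℕ) (a b : A),
    δ n (a * b) = ∑ i ∈ Finset.range (n + 1), δ i a * δ (n - i) b

/-- A locally nilpotent higher derivation: `δ_i a = 0` for `i` large (depending on `a`), and the
map `A[t] → A[t]` given by `a ↦ ∑ δ_i(a) t^i`, `t ↦ t` is an algebra automorphism. -/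
structure IsLocallyNilpotentHigherDerivation {k : Type*} {A : Type*} [CommRing k] [Ring A]
    [Algebra k A] (δ : ℕ → A →ₗ[k] A) : Prop extends IsHigherDerivation δ where
  eventually_zero : ∀ a : A, ∃ n : ℕ, ∀ i, n ≤ i → δ i a = 0
  exists_automorphism : ∃ G : A[X] ≃ₐ[k] A[X],
    G Polynomial.X = Polynomial.X ∧ ∀ (a : A) (i : ℕ), (G (Polynomial.C a)).coeff i = δ i a

/-- The invariant `ML^H(A)`: the intersection of the kernels `⋂_{i ≥ 1} ker δ_i` of all locally
nilpotent higher derivations `δ` of `A`. -/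
def makarLimanovH (k : Type*) (A : Type*) [CommRing k] [Ring A] [Algebra k A] : Set A :=
  {a | ∀ δ : ℕ → A →ₗ[k] A, IsLocallyNilpotentHigherDerivation δ → ∀ i, 1 ≤ i → δ i a = 0}

/-- The polynomial ring `A[t_1, …, t_d]` over a not necessarily commutative ring `A`, in central
variables. -/
abbrev PolyRing (A : Type*) [Ring A] (d : ℕ) : Type _ := AddMonoidAlgebra A (Fin d →₀ ℕ)

/-- `A` is strongly `LND^H`-rigid: `ML^H(A[t_1, …, t_d]) = A` for all `d ≥ 1`. -/
def IsStronglyLNDHRigid (k : Type*) (A : Type*) [CommRing k] [Ring A] [Algebra k A] : Prop :=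
  ∀ d : ℕ, 1 ≤ d →
    makarLimanovH k (PolyRing A d) =
      Set.range (fun a : A => (AddMonoidAlgebra.single 0 a : PolyRing A d))

/-! ### Cancellation -/

/-- `A` is strongly cancellative: for each `d ≥ 1`, `A[t_1, …, t_d] ≅ B[t_1, …, t_d]` implies
`A ≅ B`. -/
def IsStronglyCancellative.{a, b, c} (k : Type a) (A : Type b) [CommRing k] [Ring A]
    [Algebra k A] : Prop :=
  ∀ d : ℕ, 1 ≤ d → ∀ (B : Type c) [Ring B] [Algebra k B],
    Nonempty (PolyRing A d ≃ₐ[k] PolyRing B d) → Nonempty (A ≃ₐ[k] B)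

/-- A grading `R = ⨁ R_i` is connected if `R_0 = k` (more precisely, `k → R_0` is bijective). -/
def IsConnectedGrading {k : Type*} {R : Type*} [CommRing k] [CommRing R] [Algebra k R]
    (𝓡 : ℕ → Submodule k R) : Prop :=
  Function.Injective (algebraMap k R) ∧ 𝓡 0 = 1

end

noncomputable section

/-! ### Degrees and domains -/

namespace NatFiltration

variable {k A : Type*} [CommRing k] [Ring A] [Algebra k A] (F : NatFiltration k A)

/-! The discriminant `f` enters only through `DividesTraceDets`: the algebra has finite rank over
its center, its regular trace has central values, and `f` divides every trace determinant of size
`w`, some of which is nonzero. Let `T` be a domain that is free over `A` on central elements. Then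
the center of `T` is spanned by the same elements over the center of `A`, a basis over the center
stays a basis, and the trace of `T` extends that of `A`. Since determinants are multilinear, the
property passes from `A` to `T` (`DividesTraceDets.map`). Conversely, if `A` is factorially closed
in `T`, every element of `T` with the property lies in `A`, because it divides a nonzero determinant
with entries in `A` (`DividesTraceDets.mem_range`). So an isomorphism `A ⊗ R ≅ B ⊗ R` sends `f` into
`B`, and an automorphism of `A[t₁, …, t_d][X]` sends `f` into `A[t₁, …, t_d]`.

Effectiveness and domination are used for homomorphisms `Ψ : A → P[X]` that specialize at a scalar
`X = θ` to an embedding `j` and satisfy `Ψ f = j f`. Give `X` a large weight. If `Ψ` moved a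
generator, its degree would rise, so the test applied to the images of the generators would give a
presentation whose value has degree above `deg f`, or is zero. But that value is `Ψ f = j f`, which
is nonzero of degree `deg f`. Hence `Ψ = j` (`IsEffective.eq_C`, `IsDominating.eq_C`).

Rigidity: the automorphism attached to a locally nilpotent higher derivation of `P = A[t₁, …, t_d]`
restricts to such a `Ψ` on `A`, with `θ = 0`, so all higher components vanish on `A`. The
translations `t_j ↦ t_j + X` show that nothing outside `A` is killed by every such derivation.

Cancellation: the grading of `R` gives a dilation `R → R[X]`, the identity at `X = 1` and the
augmentation at `X = 0`. An isomorphism and the augmentations give `α : A → B` and `β : B → A`, and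
dilating the isomorphism gives a `Ψ : A → A[X]` that is the identity at `X = 1` and `β ∘ α` at `X =
0`. Thus `β ∘ α = id`. Injectivity of `β` is a count of transcendence degrees: finite GK-dimension
bounds that of the center of `A`, and the two centers have the same one because they become
isomorphic after tensoring with `R`. So `B` is algebraic over a subring of the image of `α`, on
which `β` is injective. -/

theorem mem_piece_deg (a : A) : a ∈ F.piece (F.deg a) :=
  Nat.sInf_mem (s := {i | a ∈ F.piece i}) (F.exhaustive a)

theorem deg_le_iff {a : A} {i : ℕ} : F.deg a ≤ i ↔ a ∈ F.piece i :=
  ⟨fun h => F.mono h (F.mem_piece_deg a), fun h => Nat.sInf_le h⟩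

@[simp]
theorem deg_zero : F.deg 0 = 0 :=
  Nat.le_zero.1 (F.deg_le_iff.2 (Submodule.zero_mem _))

@[simp]
theorem deg_one : F.deg 1 = 0 :=
  Nat.le_zero.1 (F.deg_le_iff.2 F.one_mem)

theorem deg_add_le_of_le {a b : A} {i : ℕ} (ha : F.deg a ≤ i) (hb : F.deg b ≤ i) :
    F.deg (a + b) ≤ i :=
  F.deg_le_iff.2 (Submodule.add_mem _ (F.deg_le_iff.1 ha) (F.deg_le_iff.1 hb))

theorem deg_smul_le (c : k) (a : A) : F.deg (c • a) ≤ F.deg a :=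
  F.deg_le_iff.2 (Submodule.smul_mem _ _ (F.mem_piece_deg a))

theorem deg_mul_le (a b : A) : F.deg (a * b) ≤ F.deg a + F.deg b :=
  F.deg_le_iff.2 (F.mul_mem (F.mem_piece_deg a) (F.mem_piece_deg b))

/-- The hypothesis `a ≠ 0` matters: `deg 0 = 0`, although `0` lies in `F_{-1}`. -/
theorem mem_prev_iff {a : A} (ha : a ≠ 0) {i : ℕ} : a ∈ F.prev i ↔ F.deg a < i := by
  cases i with
  | zero => simpa using! ha
  | succ i => exact F.deg_le_iff.symm.trans Nat.lt_succ_iff.symm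

/-- The degree function is additive on products of nonzero elements, and there are no zero
divisors. -/
def IsStrict : Prop :=
  ∀ a b : A, a ≠ 0 → b ≠ 0 → a * b ≠ 0 ∧ F.deg (a * b) = F.deg a + F.deg b

theorem symb_eq_zero {i : ℕ} {a : A} (ha : a ∈ F.piece i) : symb a ha = 0 ↔ a ∈ F.prev i :=
  Submodule.Quotient.mk_eq_zero _

/-- The product of the symbols of two nonzero elements is nonzero, so no degree is lost in
multiplying them. -/
theorem isStrict_of_isDomain (h : IsDomain F.gr) : F.IsStrict := by
  intro a b ha hb
  have key : a * b ∉ F.prev (F.deg a + F.deg b) := by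
    intro hab
    have h0 : DirectSum.of F.grPiece _ (symb a (F.mem_piece_deg a)) *
        DirectSum.of F.grPiece _ (symb b (F.mem_piece_deg b)) = 0 := by
      rw [DirectSum.of_mul_of]
      have : GradedMonoid.GMul.mul (symb a (F.mem_piece_deg a)) (symb b (F.mem_piece_deg b)) =
          (0 : F.grPiece (F.deg a + F.deg b)) :=
        (F.symb_eq_zero (F.mul_mem (F.mem_piece_deg a) (F.mem_piece_deg b))).2 hab
      rw [this, map_zero]
    rcases mul_eq_zero.1 h0 with h1 | h1
    · have := (F.symb_eq_zero _).1 (DirectSum.of_injective _ (h1.trans (map_zero _).symm))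
      exact lt_irrefl _ ((F.mem_prev_iff ha).1 this)
    · have := (F.symb_eq_zero _).1 (DirectSum.of_injective _ (h1.trans (map_zero _).symm))
      exact lt_irrefl _ ((F.mem_prev_iff hb).1 this)
  have hne : a * b ≠ 0 := fun h0 => key (h0 ▸ Submodule.zero_mem _)
  exact ⟨hne, le_antisymm (F.deg_mul_le a b) (not_lt.1 fun hlt => key ((F.mem_prev_iff hne).2 hlt))⟩

theorem IsStrict.grMul_ne_zero {F : NatFiltration k A} (h : F.IsStrict) {i j : ℕ}
    {x : F.grPiece i} {y : F.grPiece j} (hx : x ≠ 0) (hy : y ≠ 0) : F.grMul i j x y ≠ 0 := by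
  obtain ⟨⟨a, ha⟩, rfl⟩ := Submodule.Quotient.mk_surjective _ x
  obtain ⟨⟨b, hb⟩, rfl⟩ := Submodule.Quotient.mk_surjective _ y
  have hx' : a ∉ F.prev i := fun h => hx ((F.symb_eq_zero ha).2 h)
  have hy' : b ∉ F.prev j := fun h => hy ((F.symb_eq_zero hb).2 h)
  have ha0 : a ≠ 0 := fun h => hx' (h ▸ Submodule.zero_mem _)
  have hb0 : b ≠ 0 := fun h => hy' (h ▸ Submodule.zero_mem _)
  rw [F.mem_prev_iff ha0, not_lt] at hx'
  rw [F.mem_prev_iff hb0, not_lt] at hy'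
  obtain ⟨h0, h1⟩ := h a b ha0 hb0
  intro h2
  have := (F.symb_eq_zero (F.mul_mem ha hb)).1 h2
  rw [F.mem_prev_iff h0] at this
  omega

/-- The top component of a product in `gr` is the product of the top components. -/
theorem IsStrict.isDomain_gr [Nontrivial A] {F : NatFiltration k A} (h : F.IsStrict) :
    IsDomain F.gr := by
  classical
  have hmul : ∀ x y : F.gr, x ≠ 0 → y ≠ 0 → x * y ≠ 0 := by
    intro x y hx hy hxy
    have hx' : (DFinsupp.support x).Nonempty := by
      rw [Finset.nonempty_iff_ne_empty]; simpa using hx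
    have hy' : (DFinsupp.support y).Nonempty := by
      rw [Finset.nonempty_iff_ne_empty]; simpa using hy
    set i := (DFinsupp.support x).max' hx' with hi
    set j := (DFinsupp.support y).max' hy' with hj
    have hxi : x i ≠ 0 := by simpa using (DFinsupp.support x).max'_mem hx'
    have hyj : y j ≠ 0 := by simpa using (DFinsupp.support y).max'_mem hy'
    have key : (x * y) (i + j) = F.grMul i j (x i) (y j) := by
      rw [DirectSum.mul_eq_sum_support_ghas_mul, DirectSum.sum_apply,
        Finset.sum_eq_single (i, j)]
      · exact DirectSum.of_eq_same _ _
      · rintro ⟨i', j'⟩ hmem hne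
        rw [Finset.mem_product] at hmem
        apply DirectSum.of_eq_of_ne
        have h1 := Finset.le_max' _ _ hmem.1
        have h2 := Finset.le_max' _ _ hmem.2
        intro h3
        apply hne
        simp only at h1 h2 h3
        have : i' = i ∧ j' = j := by omega
        rw [this.1, this.2]
      · intro hmem
        exact absurd (Finset.mem_product.2 ⟨(DFinsupp.support x).max'_mem hx',
          (DFinsupp.support y).max'_mem hy'⟩) hmem
    rw [hxy] at key
    exact h.grMul_ne_zero hxi hyj key.symm
  have hne : (1 : F.gr) ≠ 0 := by
    intro h1
    have := (F.symb_eq_zero F.one_mem).1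
      (DirectSum.of_injective (β := F.grPiece) 0 (h1.trans (map_zero _).symm))
    exact one_ne_zero this
  refine @IsDomain.mk _ _ ?_ ⟨1, 0, hne⟩
  -- The ring structure on `gr` is given as a semiring; subtraction is expressed through the scalar
  -- `-1 : k` to pass from the absence of zero divisors to cancellation.
  have hneg : ∀ c : F.gr, (-1 : k) • c + c = 0 := fun c => by
    rw [← one_smul k c, smul_smul, mul_one, ← add_smul, neg_add_cancel]
    exact zero_smul k c
  have hsub : ∀ b c : F.gr, b ≠ c → b + (-1 : k) • c ≠ 0 := fun b c h h0 => h (by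
    rw [← add_zero b, ← hneg c, ← add_assoc, h0, zero_add])
  have hcancel : ∀ x y : F.gr, x + y = y → x = 0 := fun x y h => by
    rw [← add_zero x, ← hneg y, add_comm _ y, ← add_assoc, h]
  refine @IsCancelMulZero.mk _ _ _ ⟨fun {a} ha b c hbc => ?_⟩ ⟨fun {a} ha b c hbc => ?_⟩
  · by_contra hne'
    refine hmul a _ ha (hsub b c hne') (hcancel _ (a * c) ?_)
    rw [← mul_add, add_assoc, hneg, add_zero]
    exact hbc
  · by_contra hne'
    refine hmul _ a (hsub b c hne') ha (hcancel _ (c * a) ?_)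
    rw [← add_mul, add_assoc, hneg, add_zero]
    exact hbc

/-! ### Filtrations of monoid algebras -/

/-- The filtration induced on `A'` by a homomorphism `A' → A`. -/
def comap {A' : Type*} [Ring A'] [Algebra k A'] (φ : A' →ₐ[k] A) : NatFiltration k A' where
  piece i := (F.piece i).comap φ.toLinearMap
  mono _ _ h := Submodule.comap_mono (F.mono h)
  one_mem := by simpa using F.one_mem
  mul_mem {i j a b} ha hb := by
    simpa using F.mul_mem (i := i) (j := j) (a := φ a) (b := φ b) ha hb
  exhaustive a := F.exhaustive (φ a)

theorem deg_comap {A' : Type*} [Ring A'] [Algebra k A'] (φ : A' →ₐ[k] A) (a : A') :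
    (F.comap φ).deg a = F.deg (φ a) := rfl

theorem IsStrict.comap {F : NatFiltration k A} (h : F.IsStrict) {A' : Type*} [Ring A']
    [Algebra k A'] (φ : A' →ₐ[k] A) (hφ : Function.Injective φ) : (F.comap φ).IsStrict := by
  intro a b ha hb
  obtain ⟨h0, h1⟩ := h (φ a) (φ b) ((map_ne_zero_iff φ hφ).2 ha) ((map_ne_zero_iff φ hφ).2 hb)
  refine ⟨fun h2 => h0 (by rw [← map_mul, h2, map_zero]), ?_⟩
  simpa only [deg_comap, map_mul] using h1

section MonoidAlgebra

variable {M : Type*} [AddCommMonoid M] (ω : M →+ ℕ)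

/-- The filtration of `A[M]` for which the monomial `a m` has degree `deg a + ω m`. -/
def monoidAlgebra : NatFiltration k (AddMonoidAlgebra A M) where
  piece i :=
    { carrier := {p | ∀ m, p.coeff m ≠ 0 → F.deg (p.coeff m) + ω m ≤ i}
      zero_mem' := fun m hm => absurd rfl hm
      add_mem' := by
        intro p q hp hq m hm
        by_cases h1 : p.coeff m = 0
        · have h2 : (p + q).coeff m = q.coeff m := by simp [h1]
          rw [h2] at hm ⊢
          exact hq m hm
        · by_cases h2 : q.coeff m = 0
          · have h3 : (p + q).coeff m = p.coeff m := by simp [h2]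
            rw [h3]
            exact hp m h1
          · have h3 := hp m h1
            have h4 := hq m h2
            -- The truncated difference is harmless: `h3` forces `ω m ≤ i`.
            have h5 : F.deg (p.coeff m + q.coeff m) ≤ i - ω m :=
              F.deg_add_le_of_le (by omega) (by omega)
            simp only [AddMonoidAlgebra.coeff_add, Finsupp.add_apply]
            omega
      smul_mem' := by
        intro c p hp m hm
        have h1 : (c • p).coeff m = c • p.coeff m := rfl
        rw [h1] at hm ⊢
        exact (Nat.add_le_add_right (F.deg_smul_le _ _) _).trans
          (hp m fun h => hm (by rw [h, smul_zero])) }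
  mono i j hij p hp m hm := (hp m hm).trans hij
  one_mem := by
    classical
    intro m hm
    have h1 : (1 : AddMonoidAlgebra A M).coeff m = if 0 = m then 1 else 0 := by
      rw [AddMonoidAlgebra.one_def, AddMonoidAlgebra.coeff_single, Finsupp.single_apply]
    rw [h1] at hm ⊢
    split_ifs at hm ⊢ with h
    · simp [← h]
    · exact absurd rfl hm
  mul_mem := by
    classical
    intro i j p q hp hq m hm
    -- The first half, obtained from one nonzero term of the coefficient, makes the truncated
    -- subtraction in the second half a true one.
    have hle : ω m ≤ i + j ∧ F.deg ((p * q).coeff m) ≤ i + j - ω m := by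
      have h1 : ∀ m₁ m₂, m₁ + m₂ = m → p.coeff m₁ * q.coeff m₂ ≠ 0 →
          F.deg (p.coeff m₁ * q.coeff m₂) + ω m ≤ i + j := by
        intro m₁ m₂ h h0
        have h2 := hp m₁ (left_ne_zero_of_mul h0)
        have h3 := hq m₂ (right_ne_zero_of_mul h0)
        have h4 := F.deg_mul_le (p.coeff m₁) (q.coeff m₂)
        rw [← h, map_add]
        omega
      rw [AddMonoidAlgebra.coeff_mul] at hm ⊢
      constructor
      · obtain ⟨m₁, -, h2⟩ := Finset.exists_ne_zero_of_sum_ne_zero hm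
        obtain ⟨m₂, -, h3⟩ := Finset.exists_ne_zero_of_sum_ne_zero h2
        simp only [ne_eq, ite_eq_right_iff, Classical.not_imp] at h3
        have := h1 m₁ m₂ h3.1 h3.2
        omega
      · rw [F.deg_le_iff]
        refine Submodule.sum_mem _ fun m₁ _ => Submodule.sum_mem _ fun m₂ _ => ?_
        dsimp only
        split_ifs with h
        · by_cases h0 : p.coeff m₁ * q.coeff m₂ = 0
          · rw [h0]; exact Submodule.zero_mem _
          · have := h1 m₁ m₂ h h0
            exact F.deg_le_iff.1 (by omega)
        · exact Submodule.zero_mem _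
    omega
  exhaustive p := by
    refine ⟨p.coeff.support.sup fun m => F.deg (p.coeff m) + ω m, fun m hm => ?_⟩
    exact Finset.le_sup (f := fun m => F.deg (p.coeff m) + ω m) (Finsupp.mem_support_iff.2 hm)

theorem deg_monoidAlgebra_le {p : AddMonoidAlgebra A M} {i : ℕ} :
    (F.monoidAlgebra ω).deg p ≤ i ↔ ∀ m, p.coeff m ≠ 0 → F.deg (p.coeff m) + ω m ≤ i :=
  (F.monoidAlgebra ω).deg_le_iff

theorem le_deg_monoidAlgebra {p : AddMonoidAlgebra A M} {m : M} (hm : p.coeff m ≠ 0) :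
    F.deg (p.coeff m) + ω m ≤ (F.monoidAlgebra ω).deg p :=
  (F.deg_monoidAlgebra_le ω).1 le_rfl m hm

theorem exists_deg_monoidAlgebra {p : AddMonoidAlgebra A M} (hp : p ≠ 0) :
    ∃ m, p.coeff m ≠ 0 ∧ F.deg (p.coeff m) + ω m = (F.monoidAlgebra ω).deg p := by
  by_contra! h
  have h1 : ∀ m, p.coeff m ≠ 0 → F.deg (p.coeff m) + ω m < (F.monoidAlgebra ω).deg p :=
    fun m hm => lt_of_le_of_ne (F.le_deg_monoidAlgebra ω hm) (h m hm)
  obtain ⟨m, hm⟩ : ∃ m, p.coeff m ≠ 0 := by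
    by_contra! h2
    exact hp (AddMonoidAlgebra.ext (Finsupp.ext h2))
  have h2 := h1 m hm
  have h3 : (F.monoidAlgebra ω).deg p ≤ (F.monoidAlgebra ω).deg p - 1 :=
    (F.deg_monoidAlgebra_le ω).2 fun m hm => by have := h1 m hm; omega
  omega

theorem deg_single (m : M) {a : A} (ha : a ≠ 0) :
    (F.monoidAlgebra ω).deg (AddMonoidAlgebra.single m a) = F.deg a + ω m := by
  classical
  have hc : (AddMonoidAlgebra.single m a).coeff m = a := by simp
  refine le_antisymm ((F.deg_monoidAlgebra_le ω).2 fun m' hm' => ?_) ?_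
  · rw [AddMonoidAlgebra.coeff_single, Finsupp.single_apply] at hm' ⊢
    split_ifs at hm' ⊢ with h
    · rw [h]
    · exact absurd rfl hm'
  · have := F.le_deg_monoidAlgebra ω (p := AddMonoidAlgebra.single m a) (m := m) (by rwa [hc])
    rwa [hc] at this

/-- Among the terms of maximal degree in `p` and in `q`, unique sums provide a pair `(u, v)` whose
sum is attained only once. Any other contribution to the coefficient of `u + v` involves a term that
is not maximal, so it has lower degree and cannot cancel the leading product. -/
theorem IsStrict.monoidAlgebra [UniqueSums M] {F : NatFiltration k A} (h : F.IsStrict) :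
    (F.monoidAlgebra ω).IsStrict := by
  classical
  intro p q hp hq
  set G := F.monoidAlgebra ω
  let S : AddMonoidAlgebra A M → Finset M := fun p =>
    p.coeff.support.filter fun m => F.deg (p.coeff m) + ω m = G.deg p
  have hS : ∀ p : AddMonoidAlgebra A M, ∀ m, m ∈ S p ↔
      p.coeff m ≠ 0 ∧ F.deg (p.coeff m) + ω m = G.deg p := by
    intro p m; simp [S]
  have hne : ∀ p : AddMonoidAlgebra A M, p ≠ 0 → (S p).Nonempty := by
    intro p hp
    obtain ⟨m, hm⟩ := F.exists_deg_monoidAlgebra ω hp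
    exact ⟨m, (hS p m).2 hm⟩
  obtain ⟨u, hu, v, hv, huv⟩ := UniqueSums.uniqueAdd_of_nonempty (hne p hp) (hne q hq)
  obtain ⟨hu0, hu1⟩ := (hS p u).1 hu
  obtain ⟨hv0, hv1⟩ := (hS q v).1 hv
  obtain ⟨huv0, huv1⟩ := h _ _ hu0 hv0
  -- the coefficient of `u + v` is `p_u q_v` up to terms of lower degree
  have hrest : (p * q).coeff (u + v) - p.coeff u * q.coeff v ∈
      F.prev (F.deg (p.coeff u) + F.deg (q.coeff v)) := by
    rw [AddMonoidAlgebra.coeff_mul]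
    simp only [Finsupp.sum]
    rw [← Finset.sum_product', ← Finset.add_sum_erase _ _ (Finset.mem_product.2
      ⟨Finsupp.mem_support_iff.2 hu0, Finsupp.mem_support_iff.2 hv0⟩ : (u, v) ∈ _)]
    rw [if_pos rfl, add_sub_cancel_left]
    refine Submodule.sum_mem _ fun m hm => ?_
    split_ifs with hsum
    · by_cases h0 : p.coeff m.1 * q.coeff m.2 = 0
      · rw [h0]; exact Submodule.zero_mem _
      rw [F.mem_prev_iff h0]
      have hm1 := left_ne_zero_of_mul h0
      have hm2 := right_ne_zero_of_mul h0
      have h1 := F.le_deg_monoidAlgebra ω hm1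
      have h2 := F.le_deg_monoidAlgebra ω hm2
      have h3 := F.deg_mul_le (p.coeff m.1) (q.coeff m.2)
      have h4 : ω m.1 + ω m.2 = ω u + ω v := by rw [← map_add, ← map_add, hsum]
      have h5 : ¬ (m.1 ∈ S p ∧ m.2 ∈ S q) := by
        rintro ⟨h6, h7⟩
        obtain ⟨h8, h9⟩ := huv h6 h7 hsum
        exact (Finset.mem_erase.1 hm).1 (Prod.ext h8 h9)
      rw [hS, hS] at h5
      change _ ≤ G.deg p at h1
      change _ ≤ G.deg q at h2
      rcases Nat.lt_or_ge (F.deg (p.coeff m.1) + ω m.1) (G.deg p) with h6 | h6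
      · omega
      · rcases Nat.lt_or_ge (F.deg (q.coeff m.2) + ω m.2) (G.deg q) with h7 | h7
        · omega
        · exact absurd ⟨⟨hm1, le_antisymm h1 h6⟩, hm2, le_antisymm h2 h7⟩ h5
    · exact Submodule.zero_mem _
  have hcoeff : (p * q).coeff (u + v) ∉ F.prev (F.deg (p.coeff u) + F.deg (q.coeff v)) := by
    intro h1
    have h2 := Submodule.sub_mem _ h1 hrest
    rw [sub_sub_cancel, F.mem_prev_iff huv0] at h2
    omega
  have hc0 : (p * q).coeff (u + v) ≠ 0 := fun h1 => hcoeff (h1 ▸ Submodule.zero_mem _)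
  have h1 := F.le_deg_monoidAlgebra ω hc0
  rw [F.mem_prev_iff hc0, not_lt] at hcoeff
  rw [map_add ω] at h1
  refine ⟨fun h2 => hc0 (by rw [h2]; rfl), le_antisymm (G.deg_mul_le p q) ?_⟩
  change _ ≤ G.deg (p * q) at h1
  omega

end MonoidAlgebra

end NatFiltration

/-! ### Rank over the center -/

section QuasiBasis

variable {D : Type*} [Ring D]

theorem Subring.center_smul_def (c : Subring.center D) (a : D) : c • a = (c : D) * a := rfl

/-- Elements `d_1, …, d_n` of `D` that form a basis of `D ⊗ Q(C)` over the field of fractions `Q(C)`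
of the center `C` of `D`. -/
structure IsQuasiBasis {n : ℕ} (d : Fin n → D) : Prop where
  linearIndependent : LinearIndependent (Subring.center D) d
  exists_smul_mem : ∀ a : D, ∃ c : Subring.center D, c ≠ 0 ∧
    c • a ∈ Submodule.span (Subring.center D) (Set.range d)

/-- Adjoining `a` to a family of maximal size creates a relation, whose coefficient at `a` cannot
vanish; this coefficient is the denominator. -/
theorem LinearIndependent.isQuasiBasis {m : ℕ} {d : Fin m → D}
    (h : LinearIndependent (Subring.center D) d)
    (hmax : ∀ v : Fin (m + 1) → D, ¬ LinearIndependent (Subring.center D) v) :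
    IsQuasiBasis d := by
  refine ⟨h, fun a => ?_⟩
  have h1 := hmax (Fin.snoc d a)
  rw [Fintype.not_linearIndependent_iff] at h1
  obtain ⟨g, hg, i, hi⟩ := h1
  rw [Fin.sum_univ_castSucc] at hg
  simp only [Fin.snoc_castSucc, Fin.snoc_last] at hg
  refine ⟨g (Fin.last m), ?_, ?_⟩
  · intro h0
    rw [h0, zero_smul, add_zero] at hg
    have h2 := Fintype.linearIndependent_iff.1 h _ hg
    induction i using Fin.lastCases with
    | last => exact hi h0
    | cast i => exact hi (h2 i)
  · rw [eq_neg_of_add_eq_zero_right hg]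
    exact Submodule.neg_mem _ (Submodule.sum_mem _ fun i _ =>
      Submodule.smul_mem _ _ (Submodule.subset_span ⟨i, rfl⟩))

/-- A bound on the sizes of linearly independent families yields a quasi-basis. -/
theorem exists_isQuasiBasis_of_bounded {n : ℕ}
    (h : ∀ v : Fin (n + 1) → D, ¬ LinearIndependent (Subring.center D) v) :
    ∃ (m : ℕ) (d : Fin m → D), IsQuasiBasis d := by
  induction n with
  | zero => exact ⟨0, Fin.elim0, (linearIndependent_empty_type).isQuasiBasis h⟩
  | succ n ih =>
    by_cases h1 : ∀ v : Fin (n + 1) → D, ¬ LinearIndependent (Subring.center D) v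
    · exact ih h1
    · push Not at h1
      obtain ⟨v, hv⟩ := h1
      exact ⟨_, v, hv.isQuasiBasis h⟩

variable [IsDomain D]

/-- The map `D → Q(C) ⊗ D`. -/
abbrev toFracTensor (D : Type*) [Ring D] [IsDomain D] :
    D →ₗ[Subring.center D] FractionRing (Subring.center D) ⊗[Subring.center D] D :=
  TensorProduct.mk (Subring.center D) (FractionRing (Subring.center D)) D 1

theorem span_range_toFracTensor :
    Submodule.span (FractionRing (Subring.center D)) (Set.range (toFracTensor D)) = ⊤ := by
  rw [eq_top_iff]
  rintro x -
  induction x using TensorProduct.induction_on with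
  | zero => exact Submodule.zero_mem _
  | tmul q a =>
    have : q ⊗ₜ[Subring.center D] a = q • toFracTensor D a := by
      simp [TensorProduct.smul_tmul']
    rw [this]
    exact Submodule.smul_mem _ _ (Submodule.subset_span ⟨a, rfl⟩)
  | add x y hx hy => exact Submodule.add_mem _ hx hy

theorem linearIndependent_toFracTensor {ι : Type*} {d : ι → D}
    (h : LinearIndependent (Subring.center D) d) :
    LinearIndependent (FractionRing (Subring.center D)) (toFracTensor D ∘ d) :=
  h.of_isLocalizedModule _ (nonZeroDivisors (Subring.center D)) (toFracTensor D)

/-- A quasi-basis gives a basis of `Q(C) ⊗ D`. -/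
def IsQuasiBasis.basis {n : ℕ} {d : Fin n → D} (h : IsQuasiBasis d) :
    Module.Basis (Fin n) (FractionRing (Subring.center D))
      (FractionRing (Subring.center D) ⊗[Subring.center D] D) :=
  Module.Basis.mk (linearIndependent_toFracTensor h.linearIndependent) (by
    rw [← span_range_toFracTensor, Submodule.span_le]
    rintro _ ⟨a, rfl⟩
    obtain ⟨c, hc, hca⟩ := h.exists_smul_mem a
    have h1 : toFracTensor D (c • a) ∈ Submodule.span (FractionRing (Subring.center D))
        (Set.range (toFracTensor D ∘ d)) := by
      have h2 := Submodule.mem_map_of_mem (f := toFracTensor D) hca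
      rw [Submodule.map_span, ← Set.range_comp] at h2
      exact Submodule.span_le_restrictScalars (Subring.center D) _ _ h2
    have hc' : algebraMap (Subring.center D) (FractionRing (Subring.center D)) c ≠ 0 := by
      simpa using hc
    have h3 : toFracTensor D a =
        (algebraMap (Subring.center D) (FractionRing (Subring.center D)) c)⁻¹ •
          toFracTensor D (c • a) := by
      rw [map_smul, algebra_compatible_smul (FractionRing (Subring.center D)) c, smul_smul,
        inv_mul_cancel₀ hc', one_smul]
    rw [SetLike.mem_coe, h3]
    exact Submodule.smul_mem _ _ h1)

theorem IsQuasiBasis.basis_apply {n : ℕ} {d : Fin n → D} (h : IsQuasiBasis d) (i : Fin n) :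
    h.basis i = toFracTensor D (d i) := by
  simp [IsQuasiBasis.basis]

theorem IsQuasiBasis.not_linearIndependent {n m : ℕ} {d : Fin n → D} (h : IsQuasiBasis d)
    (hm : n < m) (v : Fin m → D) : ¬ LinearIndependent (Subring.center D) v := by
  intro hv
  have := h.basis.finiteDimensional_of_finite
  have h1 := (linearIndependent_toFracTensor hv).fintype_card_le_finrank
  rw [Module.finrank_eq_card_basis h.basis, Fintype.card_fin, Fintype.card_fin] at h1
  omega

/-- If the regular trace does not vanish then `D` has finite rank over its center. -/
theorem exists_isQuasiBasis_of_regularTrace_ne_zero {a : D} (ha : regularTrace D a ≠ 0) :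
    ∃ (m : ℕ) (d : Fin m → D), IsQuasiBasis d := by
  have hfin : Module.Finite (FractionRing (Subring.center D))
      (FractionRing (Subring.center D) ⊗[Subring.center D] D) := by
    by_contra h
    apply ha
    -- `LinearMap.trace` is zero by default on a module without a finite basis.
    rw [regularTrace, LinearMap.trace, dif_neg, LinearMap.zero_apply]
    rintro ⟨s, ⟨b⟩⟩
    exact h (Module.Finite.of_basis b)
  refine exists_isQuasiBasis_of_bounded (n := Module.finrank (FractionRing (Subring.center D))
      (FractionRing (Subring.center D) ⊗[Subring.center D] D)) fun v hv => ?_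
  have h1 := (linearIndependent_toFracTensor hv).fintype_card_le_finrank
  rw [Fintype.card_fin] at h1
  omega

/-- The regular trace in terms of a quasi-basis. -/
theorem IsQuasiBasis.regularTrace_eq {n : ℕ} {d : Fin n → D} (h : IsQuasiBasis d) {a : D}
    {c : Subring.center D} (M : Matrix (Fin n) (Fin n) (Subring.center D))
    (hM : ∀ i, c • (a * d i) = ∑ j, M j i • d j) :
    algebraMap (Subring.center D) (FractionRing (Subring.center D)) c * regularTrace D a =
      algebraMap (Subring.center D) (FractionRing (Subring.center D)) M.trace := by
  classical
  set Q := FractionRing (Subring.center D)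
  have h1 : LinearMap.toMatrix h.basis h.basis (algebraMap (Subring.center D) Q c •
      (LinearMap.mulLeft (Subring.center D) a).baseChange Q) =
      M.map (algebraMap (Subring.center D) Q) := by
    rw [← LinearEquiv.eq_symm_apply]
    refine h.basis.ext fun i => ?_
    rw [LinearMap.toMatrix_symm, Matrix.toLin_self]
    simp only [LinearMap.smul_apply, h.basis_apply, Matrix.map_apply]
    have h2 : (LinearMap.mulLeft (Subring.center D) a).baseChange Q (toFracTensor D (d i)) =
        toFracTensor D (a * d i) := by
      simp
    rw [h2, ← algebra_compatible_smul, ← map_smul, hM i, map_sum]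
    refine Finset.sum_congr rfl fun j _ => ?_
    rw [map_smul, ← algebra_compatible_smul]
  rw [regularTrace, ← smul_eq_mul, ← map_smul, LinearMap.trace_eq_matrix_trace Q h.basis, h1]
  simp only [Matrix.trace, map_sum, Matrix.diag_apply, Matrix.map_apply]
  rfl

/-- The common denominator is the product of the denominators of all `a * d i`. -/
theorem IsQuasiBasis.exists_matrix {n : ℕ} {d : Fin n → D} (h : IsQuasiBasis d) (a : D) :
    ∃ (c : Subring.center D) (M : Matrix (Fin n) (Fin n) (Subring.center D)), c ≠ 0 ∧
      ∀ i, c • (a * d i) = ∑ j, M j i • d j := by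
  choose c hc hmem using fun i => h.exists_smul_mem (a * d i)
  have h1 : ∀ i, ∃ g : Fin n → Subring.center D,
      (∏ i, c i) • (a * d i) = ∑ j, g j • d j := by
    intro i
    have h2 : (∏ i, c i) • (a * d i) ∈ Submodule.span (Subring.center D) (Set.range d) := by
      rw [← Finset.prod_erase_mul _ _ (Finset.mem_univ i), mul_smul]
      exact Submodule.smul_mem _ _ (hmem i)
    obtain ⟨g, hg⟩ := (Submodule.mem_span_range_iff_exists_fun _).1 h2
    exact ⟨g, hg.symm⟩
  choose g hg using h1
  exact ⟨∏ i, c i, Matrix.of fun j i => g i j, Finset.prod_ne_zero_iff.2 fun i _ => hc i, hg⟩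

end QuasiBasis

/-! ### Standard identities -/

section Standard

variable (k : Type*) [CommRing k]

/-- The standard polynomial of degree `m`. -/
def standardPolynomial (m : ℕ) : FreeAlgebra k ℕ :=
  ∑ σ : Equiv.Perm (Fin m),
    Equiv.Perm.sign σ • (List.ofFn fun i => FreeAlgebra.ι k (σ i : ℕ)).prod

/-- Writing the standard polynomial as an alternating map over the center makes it vanish on
families dependent over the center. -/
theorem lift_standardPolynomial {A : Type*} [Ring A] [Algebra k A] (m : ℕ) (a : ℕ → A) :
    FreeAlgebra.lift k a (standardPolynomial k m) =
      MultilinearMap.alternatization (MultilinearMap.mkPiAlgebraFin (Subring.center A) m A)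
        (fun i => a i) := by
  rw [MultilinearMap.alternatization_apply, standardPolynomial, map_sum]
  refine Finset.sum_congr rfl fun σ _ => ?_
  rw [Units.smul_def, Units.smul_def, map_zsmul, map_list_prod, List.map_ofFn,
    MultilinearMap.domDomCongr_apply, MultilinearMap.mkPiAlgebraFin_apply]
  congr 3
  ext i
  simp

theorem equivMonoidAlgebraFreeMonoid_standardPolynomial (m : ℕ) :
    FreeAlgebra.equivMonoidAlgebraFreeMonoid (standardPolynomial k m) =
      ∑ σ : Equiv.Perm (Fin m), Equiv.Perm.sign σ •
        MonoidAlgebra.single (FreeMonoid.ofList (List.ofFn fun i => (σ i : ℕ))) (1 : k) := by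
  rw [standardPolynomial, map_sum]
  refine Finset.sum_congr rfl fun σ _ => ?_
  rw [Units.smul_def, Units.smul_def, map_zsmul, map_list_prod, List.map_ofFn]
  congr 1
  have h1 : (FreeAlgebra.equivMonoidAlgebraFreeMonoid ∘ fun i => FreeAlgebra.ι k ((σ i : ℕ))) =
      fun i => MonoidAlgebra.of k (FreeMonoid ℕ) (FreeMonoid.of (σ i : ℕ)) := by
    ext1 i
    simp [FreeAlgebra.equivMonoidAlgebraFreeMonoid]
  rw [h1]
  have h2 : (List.ofFn fun i => MonoidAlgebra.of k (FreeMonoid ℕ) (FreeMonoid.of (σ i : ℕ))) =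
      (List.ofFn fun i => FreeMonoid.of (σ i : ℕ)).map (MonoidAlgebra.of k (FreeMonoid ℕ)) := by
    rw [List.map_ofFn]; rfl
  rw [h2, ← map_list_prod, MonoidAlgebra.of_apply]
  congr 1
  have h3 : (List.ofFn fun i => FreeMonoid.of (σ i : ℕ)) =
      (List.ofFn fun i => (σ i : ℕ)).map FreeMonoid.of := by
    rw [List.map_ofFn]; rfl
  rw [h3]
  generalize List.ofFn (fun i => (σ i : ℕ)) = l
  induction l with
  | nil => rfl
  | cons a l ih => rw [List.map_cons, List.prod_cons, ih, FreeMonoid.ofList_cons]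

variable {k}

/-- An algebra of finite rank over its center satisfies a standard identity. -/
theorem IsQuasiBasis.isPI {D : Type*} [Ring D] [IsDomain D] [Algebra k D] {n : ℕ} {d : Fin n → D}
    (h : IsQuasiBasis d) : IsPI k D := by
  classical
  refine ⟨standardPolynomial k (n + 1), ⟨FreeMonoid.ofList (List.ofFn fun i : Fin (n + 1) => (i : ℕ)),
    ?_, ?_⟩, fun a => ?_⟩
  -- Distinct permutations give distinct words, so the word of the identity has coefficient exactly
  -- `1`.
  · rw [equivMonoidAlgebraFreeMonoid_standardPolynomial, MonoidAlgebra.coeff_sum,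
      Finsupp.finsetSum_apply, Finset.sum_eq_single 1]
    · simp
    · intro σ _ hσ
      have : FreeMonoid.ofList (List.ofFn fun i => (σ i : ℕ)) ≠
          FreeMonoid.ofList (List.ofFn fun i : Fin (n + 1) => (i : ℕ)) := by
        intro h1
        have h2 := List.ofFn_injective (FreeMonoid.ofList.injective h1)
        exact hσ (Equiv.ext fun i => Fin.ext (congrFun h2 i))
      generalize FreeMonoid.ofList (List.ofFn fun i => (σ i : ℕ)) = u at this ⊢
      generalize FreeMonoid.ofList (List.ofFn fun i : Fin (n + 1) => (i : ℕ)) = v at this ⊢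
      rw [Units.smul_def]
      simp [this]
    · simp
  · intro m' hm'
    rw [equivMonoidAlgebraFreeMonoid_standardPolynomial, MonoidAlgebra.coeff_sum,
      Finsupp.mem_support_iff, Finsupp.finsetSum_apply] at hm'
    obtain ⟨σ, -, hσ⟩ := Finset.exists_ne_zero_of_sum_ne_zero hm'
    have : FreeMonoid.ofList (List.ofFn fun i => (σ i : ℕ)) = m' := by
      by_contra h1
      apply hσ
      generalize FreeMonoid.ofList (List.ofFn fun i => (σ i : ℕ)) = u at h1 ⊢
      rw [Units.smul_def]
      simp [h1]
    rw [← this]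
    simp [FreeMonoid.length]
  · rw [lift_standardPolynomial]
    exact AlternatingMap.map_linearDependent _ _ (h.not_linearIndependent (Nat.lt_succ_self n) _)

end Standard

/-! ### Extensions by central elements -/

/-- A ring homomorphism `ι : A → T` and central elements `e_i` of `T` such that
`T = ⨁ ι(A) e_i`. -/
structure IsFreeCentralExt {A T I : Type*} [Ring A] [Ring T] (ι : A →+* T) (e : I → T) : Prop where
  injective : Function.Injective ι
  mem_center : ∀ i, e i ∈ Subring.center T
  exists_eq : ∀ t : T, ∃ a : I →₀ A, t = a.sum fun i a => ι a * e i
  eq_zero : ∀ a : I →₀ A, (a.sum fun i a => ι a * e i) = 0 → a = 0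

theorem MultilinearMap.apply_mem_of_span_eq_top {R M N : Type*} {w : ℕ} [CommRing R]
    [AddCommGroup M] [Module R M] [AddCommGroup N] [Module R N]
    (g : MultilinearMap R (fun _ : Fin w => M) N) {S : Set M} (hS : Submodule.span R S = ⊤)
    (J : Submodule R N) (h : ∀ s : Fin w → M, (∀ i, s i ∈ S) → g s ∈ J) (m : Fin w → M) :
    g m ∈ J := by
  classical
  suffices H : ∀ (U : Finset (Fin w)) (m : Fin w → M), (∀ i ∉ U, m i ∈ S) → g m ∈ J from
    H Finset.univ m (fun i hi => absurd (Finset.mem_univ i) hi)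
  intro U
  induction U using Finset.induction_on with
  | empty => exact fun m hm => h m fun i => hm i (Finset.notMem_empty i)
  | insert i U hi ih =>
    intro m hm
    have key : ∀ x ∈ Submodule.span R S, g (Function.update m i x) ∈ J := by
      intro x hx
      induction hx using Submodule.span_induction with
      | mem x hx =>
        refine ih _ fun j hj => ?_
        by_cases hji : j = i
        · subst hji; simpa using hx
        · rw [Function.update_of_ne hji]
          exact hm j (by simp [hji, hj])
      | zero => rw [g.map_update_zero]; exact J.zero_mem
      | add x y _ _ hx hy => rw [g.map_update_add]; exact J.add_mem hx hy
      | smul c x _ hx => rw [g.map_update_smul]; exact J.smul_mem _ hx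
    have := key (m i) (hS ▸ Submodule.mem_top)
    rwa [Function.update_eq_self] at this

namespace IsFreeCentralExt

variable {A T I : Type*} [Ring A] [Ring T] {ι : A →+* T} {e : I → T} (h : IsFreeCentralExt ι e)

include h

theorem map_mem_center {c : A} (hc : c ∈ Subring.center A) : ι c ∈ Subring.center T := by
  rw [Subring.mem_center_iff] at hc ⊢
  intro t
  obtain ⟨a, rfl⟩ := h.exists_eq t
  rw [Finsupp.sum, Finset.sum_mul, Finset.mul_sum]
  refine Finset.sum_congr rfl fun i _ => ?_
  rw [mul_assoc, ← Subring.mem_center_iff.1 (h.mem_center i), ← mul_assoc, ← map_mul, hc,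
    map_mul, mul_assoc]

/-- The map induced on the centers. -/
def centerMap : Subring.center A →+* Subring.center T :=
  (ι.comp (Subring.center A).subtype).codRestrict _ fun c => h.map_mem_center c.2

theorem coe_centerMap (c : Subring.center A) : (h.centerMap c : T) = ι c := rfl

theorem centerMap_injective : Function.Injective h.centerMap := fun _ _ hc =>
  Subtype.ext (h.injective (congrArg Subtype.val hc))

/-- Comparing coefficients in `ι b * z = z * ι b` shows that the coefficients of `z` commute with
every `b`. -/
theorem exists_eq_of_mem_center {z : T} (hz : z ∈ Subring.center T) :
    ∃ c : I →₀ Subring.center A, z = c.sum fun i c => ι c * e i := by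
  classical
  obtain ⟨a, rfl⟩ := h.exists_eq z
  have ha : ∀ i, a i ∈ Subring.center A := by
    intro i
    rw [Subring.mem_center_iff]
    intro b
    have h1 := h.eq_zero (a.mapRange (fun x => b * x - x * b) (by simp)) (by
      rw [Finsupp.sum_mapRange_index (by simp)]
      have h2 := Subring.mem_center_iff.1 hz (ι b)
      rw [← sub_eq_zero, Finsupp.sum, Finset.sum_mul, Finset.mul_sum, ← Finset.sum_sub_distrib]
        at h2
      rw [← h2, Finsupp.sum]
      refine Finset.sum_congr rfl fun i _ => ?_
      rw [mul_assoc _ _ (ι b), ← Subring.mem_center_iff.1 (h.mem_center i), ← mul_assoc,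
        ← mul_assoc, ← map_mul, ← map_mul, ← sub_mul, ← map_sub])
    have h3 := DFunLike.congr_fun h1 i
    simpa [sub_eq_zero] using h3
  refine ⟨Finsupp.onFinset a.support (fun i => ⟨a i, ha i⟩) (fun i hi => ?_), ?_⟩
  · rw [Finsupp.mem_support_iff]
    exact fun h0 => hi (Subtype.ext h0)
  · rw [Finsupp.onFinset_sum _ (by simp)]
    rfl

theorem span_range : Submodule.span (Subring.center T) (Set.range ι) = ⊤ := by
  rw [eq_top_iff]
  rintro t -
  obtain ⟨a, rfl⟩ := h.exists_eq t
  refine Submodule.sum_mem _ fun i _ => ?_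
  dsimp only
  rw [Subring.mem_center_iff.1 (h.mem_center i)]
  exact Submodule.smul_mem _ (⟨e i, h.mem_center i⟩ : Subring.center T)
    (Submodule.subset_span ⟨_, rfl⟩)

/-- Central coefficients expand along the `e i` with coefficients in the center of `A`; a relation
over the center of `T` thus splits into one relation in `A` for each `i`. -/
theorem linearIndependent {κ : Type*} {d : κ → A} (hd : LinearIndependent (Subring.center A) d) :
    LinearIndependent (Subring.center T) (ι ∘ d) := by
  classical
  rw [linearIndependent_iff'] at hd ⊢
  intro s g hg j hj
  choose c hc using fun j => h.exists_eq_of_mem_center (g j).2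
  have h1 : ∀ j, (g j : T) * ι (d j) =
      ((c j).mapRange (fun x : Subring.center A => (x : A) * d j) (by simp)).sum
        (fun i a => ι a * e i) := by
    intro j
    rw [Finsupp.sum_mapRange_index (by simp), hc j, Finsupp.sum, Finset.sum_mul]
    refine Finset.sum_congr rfl fun i _ => ?_
    rw [mul_assoc, ← Subring.mem_center_iff.1 (h.mem_center i), ← mul_assoc, ← map_mul]
  have h2 : (∑ j ∈ s, (c j).mapRange (fun x : Subring.center A => (x : A) * d j) (by simp)) = 0 := by
    apply h.eq_zero
    rw [← Finsupp.sum_finsetSum_index (by simp) (by intro i a b; rw [map_add, add_mul]), ← hg]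
    exact Finset.sum_congr rfl fun j _ => (h1 j).symm
  have h3 : ∀ i, ∑ j ∈ s, c j i • d j = 0 := by
    intro i
    have := DFunLike.congr_fun h2 i
    rw [Finsupp.finsetSum_apply] at this
    simpa using! this
  have h4 : c j = 0 := Finsupp.ext fun i => hd s (fun j => c j i) (h3 i) j hj
  apply Subtype.ext
  rw [hc j, h4]
  rfl

/-- Denominators from `A` suffice for the elements of `ι(A)`, and these span `T` over its center. -/
theorem isQuasiBasis [IsDomain T] {n : ℕ} {d : Fin n → A} (hd : IsQuasiBasis d) :
    IsQuasiBasis (ι ∘ d) := by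
  refine ⟨h.linearIndependent hd.linearIndependent, fun t => ?_⟩
  have ht : t ∈ Submodule.span (Subring.center T) (Set.range ι) := h.span_range ▸ Submodule.mem_top
  induction ht using Submodule.span_induction with
  | mem t ht =>
    obtain ⟨a, rfl⟩ := ht
    obtain ⟨c, hc, hca⟩ := hd.exists_smul_mem a
    refine ⟨h.centerMap c, fun h0 => hc (h.centerMap_injective (h0.trans (map_zero _).symm)), ?_⟩
    obtain ⟨g, hg⟩ := (Submodule.mem_span_range_iff_exists_fun _).1 hca
    refine (Submodule.mem_span_range_iff_exists_fun _).2 ⟨fun i => h.centerMap (g i), ?_⟩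
    simp only [Subring.center_smul_def, coe_centerMap, Function.comp_apply, ← map_mul, ← map_sum]
      at hg ⊢
    rw [hg]
  | zero => exact ⟨1, one_ne_zero, by rw [smul_zero]; exact Submodule.zero_mem _⟩
  | add x y _ _ hx hy =>
    obtain ⟨c, hc, hcx⟩ := hx
    obtain ⟨c', hc', hcy⟩ := hy
    refine ⟨c * c', mul_ne_zero hc hc', ?_⟩
    rw [smul_add]
    refine Submodule.add_mem _ ?_ ?_
    · rw [mul_comm, mul_smul]; exact Submodule.smul_mem _ _ hcx
    · rw [mul_smul]; exact Submodule.smul_mem _ _ hcy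
  | smul z x _ hx =>
    obtain ⟨c, hc, hcx⟩ := hx
    refine ⟨c, hc, ?_⟩
    rw [smul_comm]
    exact Submodule.smul_mem _ _ hcx

end IsFreeCentralExt

/-- The rank one case, through which `DividesTraceDets.map` also gives invariance under
isomorphisms. -/
theorem IsFreeCentralExt.of_ringEquiv {A T : Type*} [Ring A] [Ring T] (φ : A ≃+* T) :
    IsFreeCentralExt (φ : A →+* T) (fun _ : Unit => (1 : T)) where
  injective := φ.injective
  mem_center _ := Subring.one_mem _
  exists_eq t := ⟨Finsupp.single () (φ.symm t), by simp⟩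
  eq_zero a ha := by
    rw [Finsupp.sum_fintype _ _ (by simp)] at ha
    ext
    simpa using ha

theorem AddMonoidAlgebra.isFreeCentralExt (A M : Type*) [Ring A] [AddCommMonoid M] :
    IsFreeCentralExt (AddMonoidAlgebra.singleZeroRingHom : A →+* AddMonoidAlgebra A M)
      (fun m : M => AddMonoidAlgebra.single m (1 : A)) where
  injective := AddMonoidAlgebra.single_right_injective
  mem_center m := Subring.mem_center_iff.2 fun p =>
    (AddMonoidAlgebra.single_commute (fun m' => AddCommute.all m m') (fun r => Commute.one_left r)
      p).eq.symm
  exists_eq p := ⟨p.coeff, by simp⟩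
  eq_zero a ha := by
    have h1 : (a.sum fun m r => AddMonoidAlgebra.single m r) = 0 := by
      rw [← ha]; simp
    have h2 := AddMonoidAlgebra.sum_coeff_single (AddMonoidAlgebra.ofCoeff a)
    exact AddMonoidAlgebra.ofCoeff_eq_zero.1 (h2.symm.trans h1)

theorem Polynomial.isFreeCentralExt (A : Type*) [Ring A] :
    IsFreeCentralExt (Polynomial.C : A →+* A[X]) (fun m : ℕ => (Polynomial.X ^ m : A[X])) where
  injective := Polynomial.C_injective
  mem_center m := Subring.mem_center_iff.2 fun p => (Polynomial.X_pow_mul).symm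
  exists_eq p := ⟨p.toFinsupp.coeff, by
    conv_lhs => rw [p.as_sum_support_C_mul_X_pow]
    rfl⟩
  eq_zero a ha := by
    ext m
    have h1 := congrArg (fun p => Polynomial.coeff p m) ha
    simp only [Finsupp.sum, Polynomial.finsetSum_coeff, Polynomial.coeff_C_mul_X_pow,
      Polynomial.coeff_zero, Finset.sum_ite_eq] at h1
    by_contra h2
    rw [if_pos (Finsupp.mem_support_iff.2 h2)] at h1
    exact h2 h1

theorem TensorProduct.isFreeCentralExt {k A R I : Type*} [CommRing k] [Ring A] [Algebra k A]
    [CommRing R] [Algebra k R] (b : Module.Basis I k R)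
    (hinj : Function.Injective (Algebra.TensorProduct.includeLeft : A →ₐ[k] A ⊗[k] R)) :
    IsFreeCentralExt
      ((Algebra.TensorProduct.includeLeft : A →ₐ[k] A ⊗[k] R) : A →+* A ⊗[k] R)
      (fun i => (1 : A) ⊗ₜ[k] b i) where
  injective := hinj
  mem_center i := Subring.mem_center_iff.2 fun t => by
    induction t using TensorProduct.induction_on with
    | zero => simp
    | tmul a r => simp [mul_comm]
    | add x y hx hy => rw [add_mul, mul_add, hx, hy]
  exists_eq t := ⟨(Algebra.TensorProduct.basis A b).repr t, by
    conv_lhs => rw [← (Algebra.TensorProduct.basis A b).linearCombination_repr t]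
    simp [Finsupp.linearCombination_apply, TensorProduct.smul_tmul']⟩
  eq_zero a ha := by
    have h1 := (Algebra.TensorProduct.basis A b).linearIndependent
    rw [linearIndependent_iff] at h1
    apply h1
    rw [← ha]
    simp [Finsupp.linearCombination_apply, TensorProduct.smul_tmul']

/-! ### Regular traces and divisors of discriminant ideals -/

section Trace

variable {D : Type*} [Ring D] [IsDomain D]

theorem regularTrace_add (a b : D) :
    regularTrace D (a + b) = regularTrace D a + regularTrace D b := by
  have : LinearMap.mulLeft (Subring.center D) (a + b) =
      LinearMap.mulLeft (Subring.center D) a + LinearMap.mulLeft (Subring.center D) b := by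
    ext x; simp [add_mul]
  rw [regularTrace, this, LinearMap.baseChange_add, map_add]
  rfl

theorem regularTrace_smul (c : Subring.center D) (a : D) :
    regularTrace D (c • a) =
      algebraMap (Subring.center D) (FractionRing (Subring.center D)) c * regularTrace D a := by
  have : LinearMap.mulLeft (Subring.center D) (c • a) =
      c • LinearMap.mulLeft (Subring.center D) a := by
    ext x; simp
  rw [regularTrace, this, LinearMap.baseChange_smul,
    algebra_compatible_smul (FractionRing (Subring.center D)) c, map_smul, smul_eq_mul]
  rfl

/-- The linear map `L` with values in the center is the regular trace. -/
def IsRegularTrace (L : D →ₗ[Subring.center D] Subring.center D) : Prop :=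
  ∀ a, algebraMap (Subring.center D) (FractionRing (Subring.center D)) (L a) = regularTrace D a

omit [IsDomain D] in
theorem algebraMap_center_injective : Function.Injective
    (algebraMap (Subring.center D) (FractionRing (Subring.center D))) :=
  IsFractionRing.injective _ _

/-- Linearity over the center is inherited from the trace, as the center embeds in its field of
fractions. -/
theorem exists_isRegularTrace
    (h : ∀ a : D, ∃ c : Subring.center D,
      algebraMap (Subring.center D) (FractionRing (Subring.center D)) c = regularTrace D a) :
    ∃ L : D →ₗ[Subring.center D] Subring.center D, IsRegularTrace L := by
  choose tr htr using h
  refine ⟨⟨⟨tr, fun a b => ?_⟩, fun c a => ?_⟩, htr⟩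
  · apply algebraMap_center_injective
    rw [map_add, htr, htr, htr, regularTrace_add]
  · apply algebraMap_center_injective
    rw [htr, regularTrace_smul, RingHom.id_apply, smul_eq_mul, map_mul, htr]

theorem IsRegularTrace.mul_eq {L : D →ₗ[Subring.center D] Subring.center D}
    (hL : IsRegularTrace L) {n : ℕ} {d : Fin n → D} (hd : IsQuasiBasis d) {a : D}
    {c : Subring.center D} (M : Matrix (Fin n) (Fin n) (Subring.center D))
    (hM : ∀ i, c • (a * d i) = ∑ j, M j i • d j) : c * L a = M.trace := by
  apply algebraMap_center_injective
  rw [map_mul, hL, hd.regularTrace_eq M hM]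

/-- The determinant of the matrix with entries `L (z_i z'_j)`. -/
def traceDet (L : D →ₗ[Subring.center D] Subring.center D) {w : ℕ} (z z' : Fin w → D) :
    Subring.center D :=
  (Matrix.of fun i j => L (z i * z' j)).det

-- The determinant is multilinear in `z` through its rows and, after transposition, in `z'` through
-- its columns, so a spanning set is enough.
omit [IsDomain D] in
theorem traceDet_mem_of_span_eq_top (L : D →ₗ[Subring.center D] Subring.center D) {w : ℕ}
    {S : Set D} (hS : Submodule.span (Subring.center D) S = ⊤)
    (J : Submodule (Subring.center D) (Subring.center D))
    (h : ∀ z z' : Fin w → D, (∀ i, z i ∈ S) → (∀ i, z' i ∈ S) → traceDet L z z' ∈ J)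
    (z z' : Fin w → D) : traceDet L z z' ∈ J := by
  let left (z' : Fin w → D) : MultilinearMap (Subring.center D) (fun _ : Fin w => D)
      (Subring.center D) :=
    (Matrix.detRowAlternating.compLinearMap (LinearMap.pi fun j =>
      L ∘ₗ LinearMap.mulRight (Subring.center D) (z' j))).toMultilinearMap
  let right (z : Fin w → D) : MultilinearMap (Subring.center D) (fun _ : Fin w => D)
      (Subring.center D) :=
    (Matrix.detRowAlternating.compLinearMap (LinearMap.pi fun i =>
      L ∘ₗ LinearMap.mulLeft (Subring.center D) (z i))).toMultilinearMap
  have hleft : ∀ z z', left z' z = traceDet L z z' := fun z z' => rfl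
  have hright : ∀ z z', right z z' = traceDet L z z' := fun z z' => by
    rw [traceDet, ← Matrix.det_transpose]; rfl
  rw [← hleft]
  refine (left z').apply_mem_of_span_eq_top hS J (fun s hs => ?_) z
  rw [hleft, ← hright]
  refine (right s).apply_mem_of_span_eq_top hS J (fun s' hs' => ?_) z'
  rw [hright]
  exact h s s' hs hs'

/-- `D` has finite rank over its center, its regular trace has values in the center, and `f`
divides all determinants of size `w` of the trace form, not all of which are zero. -/
structure DividesTraceDets (w : ℕ) (f : D) : Prop where
  exists_isQuasiBasis : ∃ (n : ℕ) (d : Fin n → D), IsQuasiBasis d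
  exists_trace : ∃ L : D →ₗ[Subring.center D] Subring.center D, IsRegularTrace L ∧
    (∀ z z' : Fin w → D, ∃ d', (traceDet L z z' : D) = d' * f) ∧
    ∃ z z' : Fin w → D, traceDet L z z' ≠ 0

theorem IsDiscriminant.dividesTraceDets {w : ℕ} (hw : 1 ≤ w) {f : D} (hf : IsDiscriminant w f)
    (hf0 : f ≠ 0) : DividesTraceDets w f := by
  obtain ⟨tr, htr, ⟨-, hdiv⟩, hgcd⟩ := hf
  obtain ⟨L, hL⟩ := exists_isRegularTrace fun a => ⟨tr a, htr a⟩
  have hLtr : ∀ a, L a = tr a := fun a => algebraMap_center_injective ((hL a).trans (htr a).symm)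
  have hdet : ∀ z z' : Fin w → D,
      (Matrix.of fun i j => tr (z i * z' j)).det = traceDet L z z' := fun z z' => by
    simp only [traceDet, hLtr]
  have hex : ∃ z z' : Fin w → D, traceDet L z z' ≠ 0 := by
    by_contra! h0
    -- If all determinants vanished, `0` would be a common divisor, so the gcd `f` would be a
    -- multiple of `0`.
    obtain ⟨c, hc⟩ := hgcd 0 ⟨⟨fun a => ⟨0, by simp⟩, fun a => ⟨0, by simp⟩⟩, by
      rintro d ⟨z, z', rfl⟩
      exact ⟨0, by rw [hdet, h0]; simp⟩⟩
    exact hf0 (by simpa using hc)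
  refine ⟨?_, L, hL, fun z z' => hdiv _ ⟨z, z', by rw [hdet]⟩, hex⟩
  obtain ⟨z, z', hz⟩ := hex
  have : ∃ a, regularTrace D a ≠ 0 := by
    by_contra! h0
    apply hz
    have : ∀ a, L a = 0 := fun a => algebraMap_center_injective (by rw [hL, h0, map_zero])
    rw [traceDet]
    simp only [this]
    -- A row exists because `w ≥ 1`; the empty determinant is `1` whatever the trace is.
    exact Matrix.det_eq_zero_of_row_eq_zero ⟨0, hw⟩ fun _ => rfl
  obtain ⟨a, ha⟩ := this
  exact exists_isQuasiBasis_of_regularTrace_ne_zero ha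

end Trace

/-! ### Traces and discriminant divisors under free central extensions -/

section Extension

variable {A T I : Type*} [Ring A] [IsDomain A] [Ring T] [IsDomain T] {ι : A →+* T} {e : I → T}
  (h : IsFreeCentralExt ι e)

include h

omit [IsDomain A] [IsDomain T] in
theorem IsFreeCentralExt.matrix_map {n : ℕ} {d : Fin n → A} {a : A} {c : Subring.center A}
    {M : Matrix (Fin n) (Fin n) (Subring.center A)}
    (hM : ∀ i, c • (a * d i) = ∑ j, M j i • d j) (i : Fin n) :
    h.centerMap c • (ι a * (ι ∘ d) i) = ∑ j, M.map h.centerMap j i • (ι ∘ d) j := by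
  have := congrArg ι (hM i)
  simpa [Subring.center_smul_def, h.coe_centerMap] using this

/-- The same matrix describes multiplication by `a` over both centers, so the traces agree on
`ι(A)`; since `ι(A)` spans `T` over its center, all traces of `T` are then central. -/
theorem IsFreeCentralExt.exists_isRegularTrace
    {L : A →ₗ[Subring.center A] Subring.center A} (hL : IsRegularTrace L)
    {n : ℕ} {d : Fin n → A} (hd : IsQuasiBasis d) :
    ∃ L' : T →ₗ[Subring.center T] Subring.center T, IsRegularTrace L' ∧
      ∀ a, L' (ι a) = h.centerMap (L a) := by
  have key : ∀ a, algebraMap (Subring.center T) (FractionRing (Subring.center T))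
      (h.centerMap (L a)) = regularTrace T (ι a) := by
    intro a
    obtain ⟨c, M, hc, hM⟩ := hd.exists_matrix a
    have h1 := hL.mul_eq hd M hM
    have h2 := (h.isQuasiBasis hd).regularTrace_eq _ (h.matrix_map hM)
    have h3 : (M.map h.centerMap).trace = h.centerMap M.trace := by
      simp [Matrix.trace]
    rw [h3, ← h1, map_mul, map_mul] at h2
    refine (mul_left_cancel₀ ?_ h2).symm
    rw [Ne, map_eq_zero_iff _ algebraMap_center_injective, map_eq_zero_iff _ h.centerMap_injective]
    exact hc
  obtain ⟨L', hL'⟩ := _root_.exists_isRegularTrace (D := T) (fun t => by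
    have ht : t ∈ Submodule.span (Subring.center T) (Set.range ι) :=
      h.span_range ▸ Submodule.mem_top
    induction ht using Submodule.span_induction with
    | mem t ht =>
      obtain ⟨a, rfl⟩ := ht
      exact ⟨_, key a⟩
    | zero =>
      refine ⟨0, ?_⟩
      have := regularTrace_smul (0 : Subring.center T) (0 : T)
      rw [zero_smul, map_zero, zero_mul] at this
      rw [this, map_zero]
    | add x y _ _ hx hy =>
      obtain ⟨c, hc⟩ := hx
      obtain ⟨c', hc'⟩ := hy
      exact ⟨c + c', by rw [map_add, hc, hc', regularTrace_add]⟩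
    | smul z x _ hx =>
      obtain ⟨c, hc⟩ := hx
      exact ⟨z * c, by rw [map_mul, hc, regularTrace_smul]⟩)
  exact ⟨L', hL', fun a => algebraMap_center_injective ((hL' (ι a)).trans (key a).symm)⟩

/-- The central multiples of `ι f` form an ideal of the center, so divisibility need only be checked
on determinants with entries from `ι(A)`, which come from `A`. -/
theorem DividesTraceDets.map {w : ℕ} {f : A} (hf : DividesTraceDets w f) :
    DividesTraceDets w (ι f) := by
  obtain ⟨⟨n, d, hd⟩, L, hL, hdiv, z₀, z₀', hz⟩ := hf
  obtain ⟨L', hL', hLL'⟩ := h.exists_isRegularTrace hL hd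
  have hdet : ∀ z z' : Fin w → A,
      traceDet L' (ι ∘ z) (ι ∘ z') = h.centerMap (traceDet L z z') := by
    intro z z'
    rw [traceDet, traceDet, RingHom.map_det]
    congr 1
    ext i j
    simp [← map_mul, hLL']
  refine ⟨⟨n, _, h.isQuasiBasis hd⟩, L', hL', ?_, ι ∘ z₀, ι ∘ z₀', ?_⟩
  · let J : Submodule (Subring.center T) (Subring.center T) :=
      { carrier := {c | ∃ d', (c : T) = d' * ι f}
        add_mem' := by
          rintro a b ⟨x, hx⟩ ⟨y, hy⟩
          exact ⟨x + y, by rw [Subring.coe_add, hx, hy, add_mul]⟩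
        zero_mem' := ⟨0, by simp⟩
        smul_mem' := by
          rintro c a ⟨x, hx⟩
          exact ⟨c * x, by rw [smul_eq_mul, Subring.coe_mul, hx, mul_assoc]⟩ }
    refine traceDet_mem_of_span_eq_top L' h.span_range J fun z z' hs hs' => ?_
    choose a ha using hs
    choose a' ha' using hs'
    obtain ⟨d', hd'⟩ := hdiv a a'
    refine ⟨ι d', ?_⟩
    have h1 : z = ι ∘ a := (funext ha).symm
    have h2 : z' = ι ∘ a' := (funext ha').symm
    rw [h1, h2, hdet, h.coe_centerMap, hd', map_mul]
  · rw [hdet]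
    exact fun h0 => hz (h.centerMap_injective (h0.trans (map_zero _).symm))

/-- An element dividing the trace determinants of `T` lies in a factorially closed subring over
which `T` is generated by central elements. -/
theorem DividesTraceDets.mem_range
    (hclosed : ∀ x y : T, x * y ≠ 0 → x * y ∈ ι.range → x ∈ ι.range ∧ y ∈ ι.range)
    {w : ℕ} {g : T} (hg : DividesTraceDets w g) : g ∈ ι.range := by
  obtain ⟨⟨n, d, hd⟩, L, hL, hdiv, z₀, z₀', hz⟩ := hg
  obtain ⟨m, b, hb⟩ : ∃ (m : ℕ) (b : Fin m → A), IsQuasiBasis b :=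
    exists_isQuasiBasis_of_bounded (n := n) fun v hv =>
      hd.not_linearIndependent (Nat.lt_succ_self n) _ (h.linearIndependent hv)
  -- Here `c * L (ι a)` is the trace of a matrix over the center of `A`, so factorial closedness
  -- gives `L (ι a)` itself.
  have htr : ∀ a, (L (ι a) : T) ∈ ι.range := by
    intro a
    by_cases h0 : L (ι a) = 0
    · rw [h0]; exact Subring.zero_mem _
    obtain ⟨c, M, hc, hM⟩ := hb.exists_matrix a
    have h1 := hL.mul_eq (h.isQuasiBasis hb) _ (h.matrix_map hM)
    have h2 : (M.map h.centerMap).trace = h.centerMap M.trace := by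
      simp [Matrix.trace]
    have h3 := congrArg (Subtype.val) (h1.trans h2)
    rw [Subring.coe_mul, h.coe_centerMap, h.coe_centerMap] at h3
    refine (hclosed (ι c) (L (ι a)) ?_ (h3 ▸ ⟨_, rfl⟩)).2
    refine mul_ne_zero ?_ (fun h4 => h0 (Subtype.ext h4))
    rw [Ne, map_eq_zero_iff _ h.injective]
    exact fun h4 => hc (Subtype.ext h4)
  -- Otherwise all determinants would vanish by multilinearity, applied with the zero ideal.
  obtain ⟨z, z', hzz⟩ : ∃ z z' : Fin w → A, traceDet L (ι ∘ z) (ι ∘ z') ≠ 0 := by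
    by_contra! h0
    refine hz ?_
    refine (Submodule.mem_bot (Subring.center T)).1
      (traceDet_mem_of_span_eq_top L h.span_range ⊥ (fun z z' hs hs' => ?_) z₀ z₀')
    choose a ha using hs
    choose a' ha' using hs'
    have h1 : z = ι ∘ a := (funext ha).symm
    have h2 : z' = ι ∘ a' := (funext ha').symm
    rw [h1, h2, h0]
    exact Submodule.zero_mem _
  have hmem : traceDet L (ι ∘ z) (ι ∘ z') ∈ ι.range.comap (Subring.center T).subtype := by
    rw [traceDet, Matrix.det_apply]
    refine Subring.sum_mem _ fun σ _ => ?_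
    rw [Units.smul_def]
    refine Subring.zsmul_mem _ (Subring.prod_mem _ fun i _ => ?_) _
    change (L (ι (z (σ i)) * ι (z' i)) : T) ∈ ι.range
    rw [← map_mul]
    exact htr _
  obtain ⟨d', hd'⟩ := hdiv (ι ∘ z) (ι ∘ z')
  have hne : d' * g ≠ 0 := by
    rw [← hd']
    exact fun h4 => hzz (Subtype.ext h4)
  exact (hclosed d' g hne (hd' ▸ hmem)).2

end Extension

/-! ### Homomorphisms into polynomial rings -/

namespace NatFiltration

variable {k A : Type*} [CommRing k] [Ring A] [Algebra k A] (F : NatFiltration k A)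

theorem IsConnected.monoidAlgebra {F : NatFiltration k A} (hF : F.IsConnected) {M : Type*}
    [AddCommMonoid M] (ω : M →+ ℕ) (hω : ∀ m, ω m = 0 → m = 0) :
    (F.monoidAlgebra ω).IsConnected := by
  classical
  refine ⟨AddMonoidAlgebra.single_right_injective.comp hF.1, le_antisymm ?_ ?_⟩
  · intro p hp
    have h0 : ∀ m, m ≠ 0 → p.coeff m = 0 := by
      intro m hm
      by_contra h1
      have := hp m h1
      exact hm (hω m (by omega))
    have h1 : p.coeff 0 ∈ F.piece 0 := by
      by_cases h2 : p.coeff 0 = 0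
      · rw [h2]; exact Submodule.zero_mem _
      · have := hp 0 h2
        exact F.deg_le_iff.1 (by omega)
    rw [hF.2, Submodule.mem_one] at h1
    obtain ⟨c, hc⟩ := h1
    rw [Submodule.mem_one]
    refine ⟨c, AddMonoidAlgebra.ext (Finsupp.ext fun m => ?_)⟩
    change (AddMonoidAlgebra.single 0 (algebraMap k A c)).coeff m = _
    rw [AddMonoidAlgebra.coeff_single, Finsupp.single_apply]
    split_ifs with h
    · rw [← h, hc]
    · exact (h0 m (Ne.symm h)).symm
  · rw [Submodule.one_le]
    exact (F.monoidAlgebra ω).one_mem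

theorem IsConnected.comap {F : NatFiltration k A} (hF : F.IsConnected) {A' : Type*} [Ring A']
    [Algebra k A'] (φ : A' →ₐ[k] A) (hφ : Function.Injective φ) : (F.comap φ).IsConnected := by
  refine ⟨?_, le_antisymm ?_ ?_⟩
  · have : (algebraMap k A : k → A) = φ ∘ algebraMap k A' := by ext; simp
    exact Function.Injective.of_comp (f := φ) (this ▸ hF.1)
  · intro a ha
    have h1 : φ a ∈ F.piece 0 := ha
    rw [hF.2, Submodule.mem_one] at h1
    obtain ⟨c, hc⟩ := h1
    exact Submodule.mem_one.2 ⟨c, hφ (by rw [AlgHom.commutes, hc])⟩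
  · rw [Submodule.one_le]
    exact (F.comap φ).one_mem

variable (k A) in
/-- The identification of `A[X]` with the monoid algebra of `ℕ`, as `k`-algebras. -/
def polynomialToMonoidAlgebra : A[X] →ₐ[k] AddMonoidAlgebra A ℕ :=
  { (Polynomial.toFinsuppIso A : A[X] →+* AddMonoidAlgebra A ℕ) with
    commutes' := fun _ => rfl }

theorem polynomialToMonoidAlgebra_injective :
    Function.Injective (polynomialToMonoidAlgebra k A) :=
  (Polynomial.toFinsuppIso A).injective

/-- The filtration of `A[X]` for which `X` has degree `N`. -/
def polynomial (N : ℕ) : NatFiltration k A[X] :=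
  (F.monoidAlgebra (AddMonoidHom.mulLeft N)).comap (polynomialToMonoidAlgebra k A)

theorem le_deg_polynomial (N : ℕ) {p : A[X]} {m : ℕ} (hm : p.coeff m ≠ 0) :
    F.deg (p.coeff m) + N * m ≤ (F.polynomial N).deg p :=
  F.le_deg_monoidAlgebra (AddMonoidHom.mulLeft N) (p := polynomialToMonoidAlgebra k A p) hm

theorem deg_polynomial_C (N : ℕ) (a : A) : (F.polynomial N).deg (Polynomial.C a) = F.deg a := by
  by_cases ha : a = 0
  · simp [ha]
  · have := F.deg_single (AddMonoidHom.mulLeft N) 0 ha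
    rw [map_zero, add_zero] at this
    rw [← this]
    rfl

theorem IsStrict.polynomial {F : NatFiltration k A} (h : F.IsStrict) (N : ℕ) :
    (F.polynomial N).IsStrict :=
  (h.monoidAlgebra _).comap _ polynomialToMonoidAlgebra_injective

theorem IsConnected.polynomial {F : NatFiltration k A} (h : F.IsConnected) {N : ℕ} (hN : 0 < N) :
    (F.polynomial N).IsConnected :=
  (h.monoidAlgebra _ fun m hm => by
    rcases Nat.mul_eq_zero.1 hm with h1 | h1
    · omega
    · exact h1).comap _ polynomialToMonoidAlgebra_injective

end NatFiltration

/-! ### Effective and dominating elements as tests for trivial homomorphisms -/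

section Test

variable {k : Type u₁} {A P : Type u₂} [CommRing k] [Ring A] [Algebra k A] [Ring P] [Algebra k P]
  {n : ℕ} {x : Fin n → A} {j : A →ₐ[k] P} {Ψ : A →ₐ[k] P[X]} {θ : k}

/-- Evaluating at `X = θ` turns a relation modulo `k` among the `Ψ (x i)` into one among the `x i`,
and `k ∩ Y = 0` makes it trivial. -/
theorem IsFreeGeneratingSet.linearIndependent_mk (hx : IsFreeGeneratingSet k x)
    (hj : Function.Injective j) (hθ : ∀ a, (Ψ a).eval (algebraMap k P θ) = j a) :
    LinearIndependent k
      (fun i => (Submodule.Quotient.mk (Ψ (x i)) : P[X] ⧸ (1 : Submodule k P[X]))) := by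
  rw [Fintype.linearIndependent_iff]
  intro g hg
  have h1 : Submodule.Quotient.mk (p := (1 : Submodule k P[X])) (Ψ (∑ i, g i • x i)) = 0 := by
    rw [← hg, map_sum]
    simp only [map_smul, ← Submodule.mkQ_apply, map_sum]
  rw [Submodule.Quotient.mk_eq_zero, Submodule.mem_one] at h1
  obtain ⟨c, hc⟩ := h1
  have h2 : algebraMap k P c = j (∑ i, g i • x i) := by
    rw [← hθ, ← hc, Polynomial.algebraMap_apply, Polynomial.eval_C]
  have h3 : algebraMap k A c = ∑ i, g i • x i := hj (by rw [AlgHom.commutes, h2])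
  have h4 : ∑ i, g i • x i = 0 := by
    refine Submodule.disjoint_def.1 hx.disjoint _ (Submodule.mem_one.2 ⟨c, h3⟩) ?_
    exact Submodule.sum_mem _ fun i _ => Submodule.smul_mem _ _ (Submodule.subset_span ⟨i, rfl⟩)
  exact Fintype.linearIndependent_iff.1 hx.linearIndependent g h4

theorem IsFreeGeneratingSet.eq_C (hx : IsFreeGeneratingSet k x)
    (h : ∀ i, Ψ (x i) = Polynomial.C (j (x i))) (a : A) : Ψ a = Polynomial.C (j a) := by
  have : Ψ = Polynomial.CAlgHom.comp j := by
    refine AlgHom.ext_of_adjoin_eq_top hx.adjoin_eq_top ?_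
    rintro _ ⟨i, rfl⟩
    exact h i
  rw [this]
  rfl

theorem lift_comp_eq (p : FreeAlgebra k (Fin n)) :
    FreeAlgebra.lift k (fun i => Ψ (x i)) p = Ψ (FreeAlgebra.lift k x p) := by
  have : FreeAlgebra.lift k (fun i => Ψ (x i)) = Ψ.comp (FreeAlgebra.lift k x) := by
    ext i; simp
  rw [this]
  rfl

theorem exists_coeff_ne_zero (hθ : ∀ a, (Ψ a).eval (algebraMap k P θ) = j a) {a : A}
    (h : Ψ a ≠ Polynomial.C (j a)) : ∃ m, 1 ≤ m ∧ (Ψ a).coeff m ≠ 0 := by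
  by_contra! h0
  apply h
  have h1 : Ψ a = Polynomial.C ((Ψ a).coeff 0) := by
    ext m
    rcases Nat.eq_zero_or_pos m with rfl | hm
    · simp
    · rw [h0 m hm, Polynomial.coeff_C_of_ne_zero (by omega)]
  rw [h1, ← hθ, h1, Polynomial.eval_C, Polynomial.coeff_C_zero]

/-- A homomorphism `A → P[X]` that specializes to `j` and is trivial on the nonzero effective
element `f` is trivial. -/
theorem IsEffective.eq_C [IsDomain P] {f : A} (hf : IsEffective k f) (hf0 : f ≠ 0)
    (hPI : IsPI k P[X]) (hj : Function.Injective j)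
    (hP : ∀ F : NatFiltration k A, F.IsStrict → ∃ FP : NatFiltration k P, FP.IsStrict ∧
      ∀ a, FP.deg (j a) = F.deg a)
    (hθ : ∀ a, (Ψ a).eval (algebraMap k P θ) = j a) (hΨf : Ψ f = Polynomial.C (j f)) (a : A) :
    Ψ a = Polynomial.C (j a) := by
  obtain ⟨n, x, hx, F, hF, htest⟩ := hf
  obtain ⟨FP, hFP, hdeg⟩ := hP F (F.isStrict_of_isDomain hF)
  refine hx.eq_C (fun i₀ => ?_) a
  by_contra hi₀
  -- The weight of `X` exceeds the degree of every generator, so any generator moved by `Ψ` rises in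
  -- degree.
  set N := (Finset.univ.sup fun i => F.deg (x i)) + 1 with hN
  have hlt : ∀ i, Ψ (x i) ≠ Polynomial.C (j (x i)) →
      F.deg (x i) < (FP.polynomial N).deg (Ψ (x i)) := by
    intro i hi
    obtain ⟨m, hm, hm0⟩ := exists_coeff_ne_zero hθ hi
    have h1 := FP.le_deg_polynomial N hm0
    have h2 : F.deg (x i) ≤ Finset.univ.sup fun i => F.deg (x i) :=
      Finset.le_sup (f := fun i => F.deg (x i)) (Finset.mem_univ i)
    have h3 : N * 1 ≤ N * m := Nat.mul_le_mul_left N hm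
    omega
  obtain ⟨p, hp, hp'⟩ := htest P[X] (FP.polynomial N) hPI (hFP.polynomial N).isDomain_gr
    (fun i => Ψ (x i)) (hx.linearIndependent_mk hj hθ)
    (fun i => by
      by_cases hi : Ψ (x i) = Polynomial.C (j (x i))
      · rw [hi, FP.deg_polynomial_C, hdeg]
      · exact (hlt i hi).le)
    ⟨i₀, hlt i₀ hi₀⟩
  -- The value of the presentation at the test elements is `Ψ f = j f`, of degree exactly `deg f`.
  rw [lift_comp_eq, hp, hΨf, FP.deg_polynomial_C, hdeg] at hp'
  rcases hp' with h1 | h1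
  · rw [Polynomial.C_eq_zero, map_eq_zero_iff j hj] at h1
    exact hf0 h1
  · exact lt_irrefl _ h1

/-- A homomorphism `A → P[X]` that specializes to `j` and is trivial on the nonzero dominating
element `f` is trivial. -/
theorem IsDominating.eq_C [IsDomain P] {f : A} (hf : IsDominating k f) (hf0 : f ≠ 0)
    (hPI : IsPI k P[X]) (hj : Function.Injective j)
    (hP : ∀ F : NatFiltration k A, F.IsStrict → F.IsConnected → ∃ FP : NatFiltration k P,
      FP.IsStrict ∧ FP.IsConnected ∧ ∀ a, FP.deg (j a) = F.deg a)
    (hθ : ∀ a, (Ψ a).eval (algebraMap k P θ) = j a) (hΨf : Ψ f = Polynomial.C (j f)) (a : A) :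
    Ψ a = Polynomial.C (j a) := by
  obtain ⟨n, x, hx, F, -, hconn, hF, htest⟩ := hf
  obtain ⟨FP, hFP, hFPconn, hdeg⟩ := hP F (F.isStrict_of_isDomain hF) hconn
  refine hx.eq_C (fun i₀ => ?_) a
  by_contra hi₀
  -- Weight `2` suffices, since domination asks only for a degree above `1`; a positive weight keeps
  -- the filtration connected.
  have hlt : 1 < (FP.polynomial 2).deg (Ψ (x i₀)) := by
    obtain ⟨m, hm, hm0⟩ := exists_coeff_ne_zero hθ hi₀
    have h1 := FP.le_deg_polynomial 2 hm0
    omega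
  have hconn' := hFPconn.polynomial (N := 2) (by omega)
  obtain ⟨p, hp, hp'⟩ := htest P[X] (FP.polynomial 2) hPI hconn' (hFP.polynomial 2).isDomain_gr
    (fun i => Ψ (x i)) (by rw [hconn'.2]; exact hx.linearIndependent_mk hj hθ)
  rw [lift_comp_eq, hp, hΨf, FP.deg_polynomial_C, hdeg] at hp'
  rcases hp' with h1 | ⟨-, h1⟩
  · rw [Polynomial.C_eq_zero, map_eq_zero_iff j hj] at h1
    exact hf0 h1
  · exact lt_irrefl _ (h1 ⟨i₀, hlt⟩)

end Test

/-! ### Translations of polynomial rings -/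

section Translation

variable {A : Type*} [Ring A] {d : ℕ}

/-- The central element `t_j + s X` of `A[t_1, …, t_d][X]`, for an integer `s`. -/
def translationElement (A : Type*) [Ring A] (j : Fin d) (s : ℤ) : (PolyRing A d)[X] :=
  Polynomial.X * Polynomial.C (s : PolyRing A d) +
    Polynomial.C (AddMonoidAlgebra.single (Finsupp.single j 1) 1)

theorem PolyRing.single_mem_center (m : Fin d →₀ ℕ) :
    (AddMonoidAlgebra.single m 1 : PolyRing A d) ∈ Subring.center (PolyRing A d) :=
  (AddMonoidAlgebra.isFreeCentralExt A (Fin d →₀ ℕ)).mem_center m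

theorem Polynomial.C_mem_center {B : Type*} [Ring B] {b : B} (hb : b ∈ Subring.center B) :
    Polynomial.C b ∈ Subring.center B[X] :=
  (Polynomial.isFreeCentralExt B).map_mem_center hb

theorem translationElement_mem_center (j : Fin d) (s : ℤ) :
    translationElement A j s ∈ Subring.center (PolyRing A d)[X] := by
  refine Subring.add_mem _ (Subring.mul_mem _ ?_ ?_) ?_
  · simpa using (Polynomial.isFreeCentralExt (PolyRing A d)).mem_center 1
  · exact Polynomial.C_mem_center (intCast_mem _ s)
  · exact Polynomial.C_mem_center (PolyRing.single_mem_center _)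

/-- The images of the monomials under `t_j ↦ t_j + s X`. -/
def translationMonomial (A : Type*) [Ring A] (j : Fin d) (s : ℤ) :
    Multiplicative (Fin d →₀ ℕ) →* (PolyRing A d)[X] where
  toFun m := Polynomial.C (AddMonoidAlgebra.single (m.toAdd.erase j) 1) *
    translationElement A j s ^ (m.toAdd j)
  map_one' := by simp [← AddMonoidAlgebra.one_def]
  map_mul' m m' := by
    have h1 : (AddMonoidAlgebra.single ((m * m').toAdd.erase j) 1 : PolyRing A d) =
        AddMonoidAlgebra.single (m.toAdd.erase j) 1 *
          AddMonoidAlgebra.single (m'.toAdd.erase j) 1 := by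
      rw [AddMonoidAlgebra.single_mul_single, toAdd_mul, Finsupp.erase_add, one_mul]
    have h2 := Subring.mem_center_iff.1 (Subring.pow_mem _
      (translationElement_mem_center (A := A) j s) (m.toAdd j))
    rw [h1, map_mul, toAdd_mul, Finsupp.add_apply, pow_add]
    exact Commute.mul_mul_mul_comm (h2 _) _ _

theorem translationMonomial_mem_center (j : Fin d) (s : ℤ) (m : Multiplicative (Fin d →₀ ℕ)) :
    translationMonomial A j s m ∈ Subring.center (PolyRing A d)[X] :=
  Subring.mul_mem _ (Polynomial.C_mem_center (PolyRing.single_mem_center _))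
    (Subring.pow_mem _ (translationElement_mem_center j s) _)

/-- The homomorphism `A[t_1, …, t_d] → A[t_1, …, t_d][X]` with `t_j ↦ t_j + s X`. -/
def translationHom (A : Type*) [Ring A] (j : Fin d) (s : ℤ) : PolyRing A d →+* (PolyRing A d)[X] :=
  AddMonoidAlgebra.liftNCRingHom (Polynomial.C.comp AddMonoidAlgebra.singleZeroRingHom)
    (translationMonomial A j s)
    (fun _ m => Subring.mem_center_iff.1 (translationMonomial_mem_center j s m) _)

theorem translationHom_single (j : Fin d) (s : ℤ) (m : Fin d →₀ ℕ) (a : A) :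
    translationHom A j s (AddMonoidAlgebra.single m a) =
      Polynomial.C (AddMonoidAlgebra.single (m.erase j) a) *
        translationElement A j s ^ (m j) := by
  have h1 : translationHom A j s (AddMonoidAlgebra.single m a) =
      Polynomial.C (AddMonoidAlgebra.single 0 a) *
        translationMonomial A j s (Multiplicative.ofAdd m) :=
    AddMonoidAlgebra.liftNC_single _ _ _ _
  rw [h1]
  change _ * (Polynomial.C (AddMonoidAlgebra.single (m.erase j) 1) * _) = _
  rw [← mul_assoc, ← map_mul, AddMonoidAlgebra.single_mul_single, zero_add, mul_one]
  rfl

/-- The endomorphism of `A[t_1, …, t_d][X]` with `t_j ↦ t_j + s X` and `X ↦ X`. -/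
def translationEnd (A : Type*) [Ring A] (j : Fin d) (s : ℤ) :
    (PolyRing A d)[X] →+* (PolyRing A d)[X] :=
  Polynomial.eval₂RingHom' (translationHom A j s) Polynomial.X
    (fun _ => (Polynomial.commute_X _).symm)

theorem translationEnd_C (j : Fin d) (s : ℤ) (p : PolyRing A d) :
    translationEnd A j s (Polynomial.C p) = translationHom A j s p :=
  Polynomial.eval₂_C _ _

theorem translationEnd_X (j : Fin d) (s : ℤ) :
    translationEnd A j s Polynomial.X = Polynomial.X :=
  Polynomial.eval₂_X _ _

theorem translationEnd_element (j : Fin d) (s s' : ℤ) :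
    translationEnd A j s (translationElement A j s') = translationElement A j (s + s') := by
  have h1 : translationHom A j s (AddMonoidAlgebra.single (Finsupp.single j 1) 1) =
      translationElement A j s := by
    rw [translationHom_single]
    simp [← AddMonoidAlgebra.one_def]
  rw [translationElement, map_add, map_mul, translationEnd_X, translationEnd_C, translationEnd_C,
    h1, map_intCast, translationElement, translationElement]
  rw [← add_assoc, Int.cast_add, map_add, mul_add,
    add_comm (Polynomial.X * Polynomial.C (s : PolyRing A d))]
  simp

/-- Shifts add by `translationEnd_element`; integer shifts are allowed so that `-1` inverts `1`. -/
theorem translationEnd_comp (j : Fin d) (s : ℤ) :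
    (translationEnd A j s).comp (translationEnd A j (-s)) = RingHom.id _ := by
  refine Polynomial.ringHom_ext (fun p => ?_) ?_
  · have h1 : ((translationEnd A j s).comp (translationEnd A j (-s))).comp Polynomial.C =
        Polynomial.C := by
      have h2 : ∀ m a, translationEnd A j s (translationEnd A j (-s)
          (Polynomial.C (AddMonoidAlgebra.single m a))) =
          Polynomial.C (AddMonoidAlgebra.single m a) := by
        intro m a
        have h3 : translationElement A j 0 =
            Polynomial.C (AddMonoidAlgebra.single (Finsupp.single j 1) 1) := by
          simp [translationElement]
        rw [translationEnd_C, translationHom_single, map_mul, translationEnd_C,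
          translationHom_single, map_pow, translationEnd_element, add_neg_cancel, h3,
          Finsupp.erase_same, pow_zero, mul_one, Finsupp.erase_idem, ← map_pow, ← map_mul,
          AddMonoidAlgebra.single_pow, AddMonoidAlgebra.single_mul_single, one_pow, mul_one]
        congr 2
        rw [Finsupp.smul_single, smul_eq_mul, mul_one, Finsupp.erase_add_single]
      exact AddMonoidAlgebra.ringHom_ext (fun r => h2 0 r) (fun m => h2 m 1)
    exact RingHom.congr_fun h1 p
  · simp [translationEnd_X]

variable (k : Type*) [CommRing k] [Algebra k A]

/-- The automorphism of `A[t_1, …, t_d][X]` with `t_j ↦ t_j + X` and `X ↦ X`. -/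
def translationEquiv (j : Fin d) : (PolyRing A d)[X] ≃ₐ[k] (PolyRing A d)[X] :=
  { RingEquiv.ofRingHom (translationEnd A j 1) (translationEnd A j (-1))
      (translationEnd_comp j 1) (by simpa using translationEnd_comp (A := A) j (-1)) with
    commutes' := fun c => by
      change translationEnd A j 1 (Polynomial.C (AddMonoidAlgebra.single 0 (algebraMap k A c))) = _
      rw [translationEnd_C, translationHom_single]
      simp }

/-- The components of the translation `t_j ↦ t_j + X`. -/
def hasse (j : Fin d) (i : ℕ) : PolyRing A d →ₗ[k] PolyRing A d :=
  ((Polynomial.lcoeff (PolyRing A d) i).restrictScalars k) ∘ₗ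
    (translationEquiv (A := A) k j).toLinearMap ∘ₗ
      (Polynomial.CAlgHom (R := k) (A := PolyRing A d)).toLinearMap

theorem hasse_apply (j : Fin d) (i : ℕ) (p : PolyRing A d) :
    hasse k j i p = (translationHom A j 1 p).coeff i := by
  rw [← translationEnd_C]
  rfl

theorem coeff_translationElement_pow (j : Fin d) (n i : ℕ) :
    (translationElement A j 1 ^ n).coeff i =
      AddMonoidAlgebra.single (Finsupp.single j (n - i)) (n.choose i : A) := by
  rw [translationElement, Int.cast_one, map_one, mul_one, Polynomial.coeff_X_add_C_pow,
    AddMonoidAlgebra.single_pow, AddMonoidAlgebra.natCast_def, AddMonoidAlgebra.single_mul_single]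
  simp

theorem hasse_single (j : Fin d) (i : ℕ) (m : Fin d →₀ ℕ) (a : A) :
    hasse k j i (AddMonoidAlgebra.single m a) =
      AddMonoidAlgebra.single (m.erase j + Finsupp.single j (m j - i)) (a * (m j).choose i) := by
  rw [hasse_apply, translationHom_single, Polynomial.coeff_C_mul, coeff_translationElement_pow,
    AddMonoidAlgebra.single_mul_single]

theorem isLocallyNilpotentHigherDerivation_hasse (j : Fin d) :
    IsLocallyNilpotentHigherDerivation (hasse (A := A) k j) where
  zero_eq := by
    refine LinearMap.ext fun p => ?_
    induction p using AddMonoidAlgebra.induction_linear with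
    | zero => simp
    | add p q hp hq => rw [map_add, map_add, hp, hq]
    | single m a =>
      rw [hasse_single]
      simp [Finsupp.erase_add_single]
  leibniz n p q := by
    simp only [hasse_apply]
    rw [map_mul, Polynomial.coeff_mul, Finset.Nat.sum_antidiagonal_eq_sum_range_succ_mk]
  eventually_zero p := ⟨(translationHom A j 1 p).natDegree + 1, fun i hi => by
    rw [hasse_apply]
    exact Polynomial.coeff_eq_zero_of_natDegree_lt hi⟩
  exists_automorphism := ⟨translationEquiv k j, translationEnd_X j 1, fun _ _ => rfl⟩

/-- The component of order `m j` strips `t_j` from the monomial `m` with binomial coefficient `1`.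
This detects the coefficient in every characteristic. -/
theorem coeff_hasse (j : Fin d) (m : Fin d →₀ ℕ) (p : PolyRing A d) :
    (hasse k j (m j) p).coeff (m.erase j) = p.coeff m := by
  classical
  induction p using AddMonoidAlgebra.induction_linear with
  | zero => simp
  | add p q hp hq => rw [map_add, AddMonoidAlgebra.coeff_add, AddMonoidAlgebra.coeff_add,
      Finsupp.add_apply, Finsupp.add_apply, hp, hq]
  | single m' a =>
    rw [hasse_single, AddMonoidAlgebra.coeff_single, AddMonoidAlgebra.coeff_single]
    by_cases hm : m' = m
    · subst hm
      simp
    · rw [Finsupp.single_eq_of_ne (Ne.symm hm)]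
      -- A smaller `t_j`-exponent gives a zero binomial coefficient; otherwise the resulting
      -- exponent can equal `m.erase j` only if `m' = m`.
      by_cases hlt : m' j < m j
      · rw [Nat.choose_eq_zero_of_lt hlt]
        simp
      · rw [Finsupp.single_eq_of_ne]
        intro h
        apply hm
        have h1 := DFunLike.congr_fun h j
        simp at h1
        ext l
        by_cases hl : l = j
        · subst hl
          omega
        · have h2 := DFunLike.congr_fun h l
          simp [Finsupp.erase_ne hl, Finsupp.single_eq_of_ne hl] at h2
          exact h2.symm

/-- Elements of `A[t_1, …, t_d]` that are killed by all locally nilpotent higher derivations lie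
in `A`. -/
theorem makarLimanovH_subset_range :
    makarLimanovH k (PolyRing A d) ⊆
      Set.range (fun a : A => (AddMonoidAlgebra.single 0 a : PolyRing A d)) := by
  classical
  intro p hp
  refine ⟨p.coeff 0, AddMonoidAlgebra.ext (Finsupp.ext fun m => ?_)⟩
  rw [AddMonoidAlgebra.coeff_single, Finsupp.single_apply]
  split_ifs with h
  · rw [h]
  · obtain ⟨j, hj⟩ : ∃ j, m j ≠ 0 := by
      by_contra! h0
      exact h (Finsupp.ext h0).symm
    rw [← coeff_hasse k j m p,
      hp _ (isLocallyNilpotentHigherDerivation_hasse k j) (m j) (Nat.one_le_iff_ne_zero.2 hj)]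
    rfl

end Translation

/-! ### Rigidity -/

section Rigidity

/-- Additivity of degrees: this is the factorial closedness required by
`DividesTraceDets.mem_range`. -/
theorem Polynomial.mem_range_C_of_mul {B : Type*} [Ring B] [IsDomain B] (x y : B[X])
    (h0 : x * y ≠ 0) (h : x * y ∈ (Polynomial.C : B →+* B[X]).range) :
    x ∈ (Polynomial.C : B →+* B[X]).range ∧ y ∈ (Polynomial.C : B →+* B[X]).range := by
  obtain ⟨b, hb⟩ := h
  have h1 := Polynomial.natDegree_mul (left_ne_zero_of_mul h0) (right_ne_zero_of_mul h0)
  rw [← hb, Polynomial.natDegree_C] at h1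
  exact ⟨⟨_, (Polynomial.eq_C_of_natDegree_eq_zero (by omega)).symm⟩,
    ⟨_, (Polynomial.eq_C_of_natDegree_eq_zero (by omega)).symm⟩⟩

/-- The image of `f` under the automorphism `G` attached to `δ` again divides the trace
determinants, so it is constant in `X`, and its constant term is `δ 0 f = f`. The test then makes
`G` trivial on `A`. -/
theorem isStronglyLNDHRigid_of_dividesTraceDets {k : Type u₁} {A : Type u₂} [CommRing k]
    [Ring A] [IsDomain A] [Algebra k A] {w : ℕ} {f : A} (hf : DividesTraceDets w f) (hf0 : f ≠ 0)
    (h : IsEffective k f ∨ IsDominating k f) : IsStronglyLNDHRigid k A := by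
  intro d _
  refine Set.Subset.antisymm (makarLimanovH_subset_range k) ?_
  rintro _ ⟨a, rfl⟩ δ hδ i hi
  obtain ⟨G, -, hG⟩ := hδ.exists_automorphism
  have hext := AddMonoidAlgebra.isFreeCentralExt A (Fin d →₀ ℕ)
  have hfP := DividesTraceDets.map hext hf
  have hfX := DividesTraceDets.map (Polynomial.isFreeCentralExt (PolyRing A d)) hfP
  have hPI : IsPI k (PolyRing A d)[X] := by
    obtain ⟨⟨n, b, hb⟩, -⟩ := hfX
    exact hb.isPI
  have hG0 : ∀ p, (G (Polynomial.C p)).coeff 0 = p := fun p => by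
    rw [hG, hδ.zero_eq]; rfl
  have hGf : G (Polynomial.C (AddMonoidAlgebra.single 0 f)) =
      Polynomial.C (AddMonoidAlgebra.single 0 f) := by
    have hfG := DividesTraceDets.map (IsFreeCentralExt.of_ringEquiv G.toRingEquiv) hfX
    obtain ⟨p, hp⟩ := DividesTraceDets.mem_range (Polynomial.isFreeCentralExt (PolyRing A d))
      Polynomial.mem_range_C_of_mul hfG
    have hp' : G (Polynomial.C (AddMonoidAlgebra.single 0 f)) = Polynomial.C p := hp.symm
    have h1 := hG0 (AddMonoidAlgebra.single 0 f)
    rw [hp', Polynomial.coeff_C_zero] at h1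
    rw [hp', h1]
  let j : A →ₐ[k] PolyRing A d :=
    { (AddMonoidAlgebra.singleZeroRingHom : A →+* PolyRing A d) with commutes' := fun _ => rfl }
  have hj : Function.Injective j := AddMonoidAlgebra.single_right_injective
  let Ψ : A →ₐ[k] (PolyRing A d)[X] := (G : _ →ₐ[k] _).comp (Polynomial.CAlgHom.comp j)
  have hθ : ∀ a, (Ψ a).eval (algebraMap k (PolyRing A d) 0) = j a := fun a => by
    rw [map_zero, ← Polynomial.coeff_zero_eq_eval_zero]
    exact hG0 _
  -- Total degree vanishes only on the trivial monomial, which preserves connectedness in the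
  -- dominating case.
  let ω : (Fin d →₀ ℕ) →+ ℕ := Finsupp.degree
  have hω : ∀ m, ω m = 0 → m = 0 := fun m hm => (Finsupp.degree_eq_zero_iff m).1 hm
  have hdeg : ∀ (F : NatFiltration k A) (a : A), (F.monoidAlgebra ω).deg (j a) = F.deg a := by
    intro F a
    by_cases ha : a = 0
    · simp [ha]
    · exact (F.deg_single ω 0 ha).trans (by simp)
  have key : Ψ a = Polynomial.C (j a) := by
    rcases h with h | h
    · exact h.eq_C hf0 hPI hj (fun F hF => ⟨F.monoidAlgebra ω, hF.monoidAlgebra ω, hdeg F⟩) hθ hGf a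
    · exact h.eq_C hf0 hPI hj (fun F hF hc => ⟨F.monoidAlgebra ω, hF.monoidAlgebra ω,
        hc.monoidAlgebra ω hω, hdeg F⟩) hθ hGf a
  have h1 := congrArg (fun p => Polynomial.coeff p i) key
  simp only [Polynomial.coeff_C_of_ne_zero (Nat.one_le_iff_ne_zero.1 hi)] at h1
  rw [← hG]
  exact h1

end Rigidity

/-! ### Transcendence degree and GK-dimension -/

section GKDim

variable {k A : Type*} [CommRing k] [IsDomain k] [Ring A] [Algebra k A]

theorem card_le_fracRank {M ι : Type*} [AddCommGroup M] [Module k M] [Module.Finite k M]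
    [Fintype ι] {v : ι → M} (hv : LinearIndependent k v) : Fintype.card ι ≤ fracRank k M :=
  (hv.of_isLocalizedModule (FractionRing k) (nonZeroDivisors k)
    (TensorProduct.mk k (FractionRing k) M 1)).fintype_card_le_finrank

omit [IsDomain k] in
theorem AlgebraicIndependent.linearIndependent_prod_pow {C : Type*} [CommRing C] [Algebra k C]
    {m : ℕ} {x : Fin m → C} (hx : AlgebraicIndependent k x) :
    LinearIndependent k (fun e : Fin m →₀ ℕ => ∏ i, x i ^ e i) := by
  have h1 := (MvPolynomial.basisMonomials (Fin m) k).linearIndependent.map'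
    (MvPolynomial.aeval x).toLinearMap (LinearMap.ker_eq_bot.2 hx)
  have h2 : (fun e : Fin m →₀ ℕ => ∏ i, x i ^ e i) =
      (MvPolynomial.aeval x).toLinearMap ∘ (MvPolynomial.basisMonomials (Fin m) k) := by
    ext e
    simp [MvPolynomial.aeval_monomial, Finsupp.prod_fintype]
  rw [h2]
  exact h1

omit [IsDomain k] in
theorem prod_pow_mem_pow {C : Type*} [CommRing C] [Algebra k C] {m : ℕ} (x : Fin m → C)
    (V : Submodule k C) (hV : ∀ e : Fin m → ℕ, (∀ i, e i ≤ 1) → ∏ i, x i ^ e i ∈ V) (n : ℕ)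
    (e : Fin m → ℕ) (he : ∀ i, e i ≤ n) : ∏ i, x i ^ e i ∈ V ^ n := by
  induction n generalizing e with
  | zero =>
    have : ∏ i, x i ^ e i = 1 := Finset.prod_eq_one fun i _ => by
      rw [Nat.le_zero.1 (he i), pow_zero]
    rw [this, pow_zero]
    exact Submodule.one_le.1 le_rfl
  | succ n ih =>
    -- Split off one factor of each variable that occurs: it lies in `V`, and the remaining
    -- exponents are at most `n`.
    have : ∏ i, x i ^ e i = (∏ i, x i ^ (e i - 1)) * ∏ i, x i ^ (min (e i) 1) := by
      rw [← Finset.prod_mul_distrib]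
      refine Finset.prod_congr rfl fun i _ => ?_
      rw [← pow_add]
      congr 1
      omega
    rw [this, pow_succ]
    exact Submodule.mul_mem_mul (ih _ fun i => by have := he i; omega)
      (hV _ fun i => min_le_right _ _)

/-- If `V` is spanned by the monomials with exponents at most `1`, then `V ^ n` contains the `(n +
1) ^ m` independent monomials with exponents at most `n`, so `log_n` of its rank is at least `m`. -/
theorem natCast_le_gkDim {m : ℕ} {x : Fin m → Subalgebra.center k A}
    (hx : AlgebraicIndependent k x) : (m : EReal) ≤ gkDim k A := by
  classical
  let W : Submodule k (Subalgebra.center k A) :=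
    Submodule.span k (Set.range fun e : Fin m → Fin 2 => ∏ i, x i ^ (e i : ℕ))
  have hW : W.FG := Submodule.fg_span (Set.finite_range _)
  let V : Submodule k A := W.map (Subalgebra.center k A).val.toLinearMap
  have hV : V.FG := hW.map _
  have hmem : ∀ (n : ℕ) (e : Fin m → ℕ), (∀ i, e i ≤ n) →
      ((∏ i, x i ^ e i : Subalgebra.center k A) : A) ∈ V ^ n := by
    intro n e he
    have h1 := prod_pow_mem_pow x W (fun e he => Submodule.subset_span
      ⟨fun i => ⟨e i, Nat.lt_succ_of_le (he i)⟩, rfl⟩) n e he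
    have h2 := Submodule.mem_map_of_mem (f := (Subalgebra.center k A).val.toLinearMap) h1
    rwa [Submodule.map_pow] at h2
  have hrank : ∀ n : ℕ, (n + 1) ^ m ≤ fracRank k ↥(V ^ n) := by
    intro n
    have : Module.Finite k ↥(V ^ n) := Module.Finite.iff_fg.2 (hV.pow n)
    let v : (Fin m → Fin (n + 1)) → ↥(V ^ n) := fun e =>
      ⟨((∏ i, x i ^ (e i : ℕ) : Subalgebra.center k A) : A),
        hmem n _ fun i => Nat.lt_succ_iff.1 (e i).2⟩
    have hv : LinearIndependent k v := by
      have h1 := hx.linearIndependent_prod_pow.comp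
        (fun e : Fin m → Fin (n + 1) => Finsupp.equivFunOnFinite.symm fun i => (e i : ℕ))
        (fun e e' h => funext fun i => Fin.ext (by
          simpa using DFunLike.congr_fun h i))
      have h2 := h1.map' (Subalgebra.center k A).val.toLinearMap
        (LinearMap.ker_eq_bot.2 Subtype.val_injective)
      exact LinearIndependent.of_comp (V ^ n).subtype h2
    have h3 := card_le_fracRank hv
    simpa using h3
  refine le_trans ?_ (le_iSup (fun V : {V : Submodule k A // V.FG} =>
    Filter.limsup (fun n : ℕ => ((Real.logb (n : ℝ) (fracRank k ↥(V.1 ^ n) : ℝ) : ℝ) : EReal))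
      Filter.atTop) ⟨V, hV⟩)
  refine Filter.le_limsup_of_frequently_le (Filter.Eventually.frequently ?_)
  filter_upwards [Filter.eventually_ge_atTop 2] with n hn
  have h1 : ((n : ℝ)) ^ m ≤ (fracRank k ↥(V ^ n) : ℝ) := by
    have : n ^ m ≤ fracRank k ↥(V ^ n) :=
      (Nat.pow_le_pow_left (Nat.le_succ n) m).trans (hrank n)
    exact_mod_cast this
  have hn' : (1 : ℝ) < n := by exact_mod_cast hn
  have h2 : (m : ℝ) ≤ Real.logb n (fracRank k ↥(V ^ n) : ℝ) := by
    rw [Real.le_logb_iff_rpow_le hn' (lt_of_lt_of_le (by positivity) h1), Real.rpow_natCast]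
    exact h1
  exact_mod_cast h2

theorem finite_of_gkDim_lt_top (h : gkDim k A < ⊤) {ι : Type*} {x : ι → Subalgebra.center k A}
    (hx : AlgebraicIndependent k x) : Finite ι := by
  by_contra hinf
  rw [not_finite_iff_infinite] at hinf
  have h1 : ∀ m : ℕ, (m : EReal) ≤ gkDim k A := fun m =>
    natCast_le_gkDim (hx.comp (fun i : Fin m => Infinite.natEmbedding ι i)
      ((Infinite.natEmbedding ι).injective.comp Fin.val_injective))
  refine h.ne (EReal.eq_top_iff_forall_lt _ |>.2 fun y => ?_)
  obtain ⟨n, hn⟩ := exists_nat_gt y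
  exact lt_of_lt_of_le (by exact_mod_cast hn) (h1 n)

end GKDim

/-! ### Transcendence bases of tensor products -/

section Trdeg

variable {k C R : Type*} [CommRing k] [IsDomain k] [CommRing C] [Algebra k C] [CommRing R]
  [Algebra k R]

/-- The tensor product of the two injective evaluation maps is injective by flatness, and `k[ι] ⊗
k[κ]` is `k[ι ⊕ κ]`. -/
theorem AlgebraicIndependent.sumElim_tmul [Module.Flat k R] {ι κ : Type*} {c : ι → C} {r : κ → R}
    (hc : AlgebraicIndependent k c) (hr : AlgebraicIndependent k r) :
    AlgebraicIndependent k
      (Sum.elim (fun i => c i ⊗ₜ[k] (1 : R)) (fun j => (1 : C) ⊗ₜ[k] r j)) := by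
  have h1 : Function.Injective
      (Algebra.TensorProduct.map (MvPolynomial.aeval (R := k) c) (MvPolynomial.aeval (R := k) r)) := by
    have h2 : Function.Injective
        (LinearMap.lTensor (MvPolynomial ι k) (MvPolynomial.aeval (R := k) r).toLinearMap) :=
      Module.Flat.lTensor_preserves_injective_linearMap _ hr
    have h3 : Function.Injective
        (LinearMap.rTensor R (MvPolynomial.aeval (R := k) c).toLinearMap) :=
      Module.Flat.rTensor_preserves_injective_linearMap _ hc
    have h4 := h3.comp h2
    rw [← LinearMap.coe_comp, LinearMap.rTensor_comp_lTensor] at h4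
    exact h4
  have h2 : MvPolynomial.aeval
      (Sum.elim (fun i => c i ⊗ₜ[k] (1 : R)) (fun j => (1 : C) ⊗ₜ[k] r j)) =
      (Algebra.TensorProduct.map (MvPolynomial.aeval (R := k) c)
        (MvPolynomial.aeval (R := k) r)).comp
        (MvPolynomial.tensorEquivSum k ι κ k).symm.toAlgHom := by
    apply MvPolynomial.algHom_ext
    rintro (i | j)
    · have : (MvPolynomial.tensorEquivSum k ι κ k).symm (MvPolynomial.X (Sum.inl i)) =
          MvPolynomial.X i ⊗ₜ 1 := by
        rw [AlgEquiv.symm_apply_eq, MvPolynomial.tensorEquivSum_X_tmul_one]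
      simp [this]
    · have : (MvPolynomial.tensorEquivSum k ι κ k).symm (MvPolynomial.X (Sum.inr j)) =
          1 ⊗ₜ MvPolynomial.X j := by
        rw [AlgEquiv.symm_apply_eq, MvPolynomial.tensorEquivSum_one_tmul_X]
      simp [this]
  rw [AlgebraicIndependent, h2]
  exact h1.comp (MvPolynomial.tensorEquivSum k ι κ k).symm.injective

omit [IsDomain k] in
theorem IsAlgebraic.adjoin_map {S S' : Type*} [CommRing S] [Algebra k S] [CommRing S']
    [Algebra k S'] {φ : S →ₐ[k] S'} (hφ : Function.Injective φ) {U : Set S} {U' : Set S'}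
    (hU : ∀ u ∈ U, φ u ∈ U') {s : S} (hs : IsAlgebraic (Algebra.adjoin k U) s) :
    IsAlgebraic (Algebra.adjoin k U') (φ s) := by
  have hle : (Algebra.adjoin k U).map φ ≤ Algebra.adjoin k U' := by
    rw [AlgHom.map_adjoin]
    exact Algebra.adjoin_mono (by rintro _ ⟨u, hu, rfl⟩; exact hU u hu)
  let g : Algebra.adjoin k U →ₐ[k] Algebra.adjoin k U' :=
    (φ.comp (Algebra.adjoin k U).val).codRestrict _ fun a =>
      hle (Subalgebra.mem_map.2 ⟨a, a.2, rfl⟩)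
  refine hs.ringHom_of_comp_eq (g : _ →+* _) (φ : S →+* S') ?_ rfl
  exact fun a b hab => Subtype.ext (hφ (congrArg Subtype.val hab))

theorem IsTranscendenceBasis.sumElim_tmul [Module.Flat k R] [IsDomain (C ⊗[k] R)]
    (hL : Function.Injective (Algebra.TensorProduct.includeLeft : C →ₐ[k] C ⊗[k] R))
    (hR : Function.Injective (Algebra.TensorProduct.includeRight : R →ₐ[k] C ⊗[k] R))
    {ι κ : Type*} {c : ι → C} {r : κ → R}
    (hc : IsTranscendenceBasis k c) (hr : IsTranscendenceBasis k r) :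
    IsTranscendenceBasis k
      (Sum.elim (fun i => c i ⊗ₜ[k] (1 : R)) (fun j => (1 : C) ⊗ₜ[k] r j)) := by
  rw [isTranscendenceBasis_iff_algebraicIndependent_isAlgebraic]
  refine ⟨hc.1.sumElim_tmul hr.1, ⟨fun t => ?_⟩⟩
  induction t using TensorProduct.induction_on with
  | zero => exact isAlgebraic_zero
  | add x y hx hy => exact hx.add hy
  | tmul a b =>
    have : a ⊗ₜ[k] b = (Algebra.TensorProduct.includeLeft : C →ₐ[k] C ⊗[k] R) a *
        (Algebra.TensorProduct.includeRight : R →ₐ[k] C ⊗[k] R) b := by simp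
    rw [this]
    refine IsAlgebraic.mul ?_ ?_
    · refine IsAlgebraic.adjoin_map hL ?_ (hc.isAlgebraic.isAlgebraic a)
      rintro _ ⟨i, rfl⟩
      exact ⟨Sum.inl i, rfl⟩
    · refine IsAlgebraic.adjoin_map hR ?_ (hr.isAlgebraic.isAlgebraic b)
      rintro _ ⟨i, rfl⟩
      exact ⟨Sum.inr i, rfl⟩

end Trdeg

/-! ### Graded extensions -/

section Grading

variable {k R : Type*} [CommRing k] [CommRing R] [Algebra k R] (𝓡 : ℕ → Submodule k R)
  [GradedAlgebra 𝓡]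

/-- The homomorphism `R → R[X]` that sends `r` of degree `i` to `r X ^ i`. -/
def gradingHom : R →ₐ[k] R[X] :=
  (DirectSum.toAlgebra k (fun i => 𝓡 i)
    (fun i => ((Polynomial.monomial i).restrictScalars k) ∘ₗ (𝓡 i).subtype)
    (by simp [GradedMonoid.GOne.one])
    (by intro i j a b; simp [GradedMonoid.GMul.mul, Polynomial.monomial_mul_monomial])).comp
    (DirectSum.decomposeAlgEquiv 𝓡).toAlgHom

theorem gradingHom_of_mem {i : ℕ} {r : R} (hr : r ∈ 𝓡 i) :
    gradingHom 𝓡 r = Polynomial.monomial i r := by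
  have h1 : DirectSum.decomposeAlgEquiv 𝓡 r = DirectSum.of (fun i => 𝓡 i) i ⟨r, hr⟩ :=
    DirectSum.decompose_of_mem 𝓡 hr
  simp only [gradingHom, AlgHom.comp_apply]
  erw [h1]
  exact DirectSum.toAddMonoid_of (fun i =>
    (((Polynomial.monomial i).restrictScalars k) ∘ₗ (𝓡 i).subtype).toAddMonoidHom) i ⟨r, hr⟩

theorem eval_one_gradingHom (r : R) : (gradingHom 𝓡 r).eval 1 = r := by
  induction r using DirectSum.Decomposition.inductionOn 𝓡 with
  | zero => simp
  | homogeneous r => rw [gradingHom_of_mem 𝓡 r.2, Polynomial.eval_monomial, one_pow, mul_one]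
  | add a b ha hb => rw [map_add, Polynomial.eval_add, ha, hb]

variable {𝓡} (h𝓡 : IsConnectedGrading 𝓡)

include h𝓡

theorem coeff_zero_gradingHom_mem (r : R) :
    (gradingHom 𝓡 r).coeff 0 ∈ (⊥ : Subalgebra k R) := by
  induction r using DirectSum.Decomposition.inductionOn 𝓡 with
  | zero => simp
  | @homogeneous i r =>
    rw [gradingHom_of_mem 𝓡 r.2, Polynomial.coeff_monomial]
    split_ifs with h
    · subst h
      obtain ⟨r, hr⟩ := r
      rw [h𝓡.2, Submodule.mem_one] at hr
      exact Algebra.mem_bot.2 hr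
    · exact Subalgebra.zero_mem _
  | add a b ha hb => rw [map_add, Polynomial.coeff_add]; exact Subalgebra.add_mem _ ha hb

/-- The augmentation of a connected graded algebra. -/
def gradingAug : R →ₐ[k] k :=
  (Algebra.botEquivOfInjective h𝓡.1).toAlgHom.comp
    (AlgHom.codRestrict
      ({ (Polynomial.constantCoeff.comp (gradingHom 𝓡 : R →+* R[X])) with
        commutes' := fun c => by
          simp [Polynomial.constantCoeff] } : R →ₐ[k] R) ⊥
      (coeff_zero_gradingHom_mem h𝓡))

theorem algebraMap_gradingAug (r : R) :
    algebraMap k R (gradingAug h𝓡 r) = (gradingHom 𝓡 r).coeff 0 := by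
  obtain ⟨c, hc⟩ := Algebra.mem_bot.1 (coeff_zero_gradingHom_mem h𝓡 r)
  have h1 : gradingAug h𝓡 r = c := by
    simp only [gradingAug, AlgHom.comp_apply]
    have : (AlgHom.codRestrict
      ({ (Polynomial.constantCoeff.comp (gradingHom 𝓡 : R →+* R[X])) with
        commutes' := fun c => by
          simp [Polynomial.constantCoeff] } : R →ₐ[k] R) ⊥
      (coeff_zero_gradingHom_mem h𝓡)) r = algebraMap k (⊥ : Subalgebra k R) c :=
      Subtype.ext hc.symm
    rw [this]
    simp
  rw [h1, hc]

variable (A : Type*) [Ring A] [Algebra k A]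

omit h𝓡 in
variable (𝓡) in
theorem commute_C_map_includeRight (a : A) (r : R) :
    Commute (((Polynomial.CAlgHom (R := k)).comp
        (Algebra.TensorProduct.includeLeft : A →ₐ[k] A ⊗[k] R)) a)
      (((Polynomial.mapAlgHom (Algebra.TensorProduct.includeRight : R →ₐ[k] A ⊗[k] R)).comp
        (gradingHom 𝓡)) r) := by
  have key : ∀ q : R[X], Commute (Polynomial.C (a ⊗ₜ[k] (1 : R))) (q.map
      ((Algebra.TensorProduct.includeRight : R →ₐ[k] A ⊗[k] R) : R →+* A ⊗[k] R)) := by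
    intro q
    induction q using Polynomial.induction_on' with
    | add p q hp hq => rw [Polynomial.map_add]; exact hp.add_right hq
    | monomial n r =>
      rw [Polynomial.map_monomial, Commute, SemiconjBy, Polynomial.C_mul_monomial,
        Polynomial.monomial_mul_C]
      simp
  exact key _

omit h𝓡 in
variable (𝓡) in
/-- The homomorphism `A ⊗ R → (A ⊗ R)[X]` given by the grading of `R`. -/
def tensorGradingHom : A ⊗[k] R →ₐ[k] (A ⊗[k] R)[X] :=
  Algebra.TensorProduct.lift (Polynomial.CAlgHom.comp Algebra.TensorProduct.includeLeft)
    ((Polynomial.mapAlgHom Algebra.TensorProduct.includeRight).comp (gradingHom 𝓡))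
    (commute_C_map_includeRight 𝓡 A)

omit h𝓡 in
theorem tensorGradingHom_tmul (a : A) (r : R) :
    tensorGradingHom 𝓡 A (a ⊗ₜ r) = Polynomial.C (a ⊗ₜ[k] 1) *
      (gradingHom 𝓡 r).map
        ((Algebra.TensorProduct.includeRight : R →ₐ[k] A ⊗[k] R) : R →+* A ⊗[k] R) := by
  rw [tensorGradingHom, Algebra.TensorProduct.lift_tmul]
  rfl

omit h𝓡 in
theorem tensorGradingHom_includeLeft (a : A) :
    tensorGradingHom 𝓡 A (a ⊗ₜ 1) = Polynomial.C (a ⊗ₜ[k] 1) := by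
  rw [tensorGradingHom_tmul]
  simp

omit h𝓡 in
theorem eval_one_tensorGradingHom (t : A ⊗[k] R) : (tensorGradingHom 𝓡 A t).eval 1 = t := by
  induction t using TensorProduct.induction_on with
  | zero => simp
  | add x y hx hy => rw [map_add, Polynomial.eval_add, hx, hy]
  | tmul a r =>
    have h1 := Polynomial.eval₂_at_apply (p := gradingHom 𝓡 r)
      ((Algebra.TensorProduct.includeRight : R →ₐ[k] A ⊗[k] R) : R →+* A ⊗[k] R) 1
    rw [map_one, ← Polynomial.eval_map, eval_one_gradingHom] at h1
    rw [tensorGradingHom_tmul, Polynomial.eval_C_mul, h1]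
    simp

theorem commute_algebraMap_gradingAug (a : A) (r : R) :
    Commute (AlgHom.id k A a) (((Algebra.ofId k A).comp (gradingAug h𝓡)) r) :=
  (Algebra.commutes (gradingAug h𝓡 r) a).symm

/-- The augmentation `A ⊗ R → A`. -/
def tensorAug : A ⊗[k] R →ₐ[k] A :=
  Algebra.TensorProduct.lift (AlgHom.id k A) ((Algebra.ofId k A).comp (gradingAug h𝓡))
    (commute_algebraMap_gradingAug h𝓡 A)

theorem tensorAug_includeLeft (a : A) : tensorAug h𝓡 A (a ⊗ₜ 1) = a := by
  simp [tensorAug]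

theorem coeff_zero_tensorGradingHom (t : A ⊗[k] R) :
    (tensorGradingHom 𝓡 A t).coeff 0 = tensorAug h𝓡 A t ⊗ₜ 1 := by
  induction t using TensorProduct.induction_on with
  | zero => simp
  | add x y hx hy => rw [map_add, Polynomial.coeff_add, hx, hy, map_add, TensorProduct.add_tmul]
  | tmul a r =>
    rw [tensorGradingHom_tmul, Polynomial.coeff_C_mul, Polynomial.coeff_map,
      ← algebraMap_gradingAug h𝓡, tensorAug, Algebra.TensorProduct.lift_tmul]
    have : (AlgHom.id k A a) * ((Algebra.ofId k A).comp (gradingAug h𝓡)) r =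
        gradingAug h𝓡 r • a := by
      rw [Algebra.smul_def, Algebra.commutes]
      rfl
    rw [this, TensorProduct.smul_tmul, Algebra.algebraMap_eq_smul_one]
    simp

theorem includeLeft_injective_of_connected :
    Function.Injective (Algebra.TensorProduct.includeLeft : A →ₐ[k] A ⊗[k] R) := fun a b hab => by
  have h1 : a ⊗ₜ[k] (1 : R) = b ⊗ₜ 1 := hab
  rw [← tensorAug_includeLeft h𝓡 A a, h1, tensorAug_includeLeft]

/-- The dilation embeds `A ⊗ R` in a polynomial ring over a domain, where degrees add. Elements
whose dilation has degree zero come from `A`, by comparing `X = 1` with `X = 0`. -/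
theorem mem_range_includeLeft_of_mul [IsDomain (A ⊗[k] R)] (x y : A ⊗[k] R) (h0 : x * y ≠ 0)
    (h : x * y ∈ ((Algebra.TensorProduct.includeLeft : A →ₐ[k] A ⊗[k] R) :
      A →+* A ⊗[k] R).range) :
    x ∈ ((Algebra.TensorProduct.includeLeft : A →ₐ[k] A ⊗[k] R) : A →+* A ⊗[k] R).range ∧
      y ∈ ((Algebra.TensorProduct.includeLeft : A →ₐ[k] A ⊗[k] R) : A →+* A ⊗[k] R).range := by
  have hne : ∀ t : A ⊗[k] R, t ≠ 0 → tensorGradingHom 𝓡 A t ≠ 0 := fun t ht h1 => ht (by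
    rw [← eval_one_tensorGradingHom (𝓡 := 𝓡) A t, h1, Polynomial.eval_zero])
  have hmem : ∀ t : A ⊗[k] R, (tensorGradingHom 𝓡 A t).natDegree = 0 →
      t ∈ ((Algebra.TensorProduct.includeLeft : A →ₐ[k] A ⊗[k] R) : A →+* A ⊗[k] R).range := by
    intro t ht
    refine ⟨tensorAug h𝓡 A t, ?_⟩
    have h1 := eval_one_tensorGradingHom (𝓡 := 𝓡) A t
    rw [Polynomial.eq_C_of_natDegree_eq_zero ht, Polynomial.eval_C,
      coeff_zero_tensorGradingHom h𝓡] at h1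
    exact h1
  obtain ⟨a, ha⟩ := h
  have h1 := Polynomial.natDegree_mul (hne x (left_ne_zero_of_mul h0))
    (hne y (right_ne_zero_of_mul h0))
  have h2 : tensorGradingHom 𝓡 A (x * y) = Polynomial.C (a ⊗ₜ 1) := by
    rw [← ha]
    exact tensorGradingHom_includeLeft A a
  rw [← map_mul, h2, Polynomial.natDegree_C] at h1
  exact ⟨hmem x (by omega), hmem y (by omega)⟩

end Grading

/-! ### Cancellation -/

/-! ### Centers of tensor products -/

section CenterTensor

variable {k R : Type*} [CommRing k] [CommRing R] [Algebra k R] [Module.Free k R]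

/-- As `R` is commutative, `1 ⊗ R` is central, so commuting with `A ⊗ 1` already means being
central. -/
theorem center_tensorProduct (A : Type*) [Ring A] [Algebra k A] :
    Subalgebra.center k (A ⊗[k] R) =
      (Algebra.TensorProduct.map (Subalgebra.center k A).val (AlgHom.id k R)).range := by
  rw [← Subalgebra.centralizer_coe_range_includeLeft_eq_center_tensorProduct]
  refine le_antisymm (Subalgebra.center_le_centralizer k _) fun t ht => ?_
  rw [Subalgebra.mem_centralizer_iff] at ht
  rw [Subalgebra.mem_center_iff]
  intro s
  induction s using TensorProduct.induction_on with
  | zero => simp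
  | add x y hx hy => rw [add_mul, mul_add, hx, hy]
  | tmul a r =>
    have h1 : ∀ u : A ⊗[k] R, (1 ⊗ₜ[k] r) * u = u * (1 ⊗ₜ[k] r) := by
      intro u
      induction u using TensorProduct.induction_on with
      | zero => simp
      | add x y hx hy => rw [add_mul, mul_add, hx, hy]
      | tmul a' r' => simp [mul_comm]
    have h2 : a ⊗ₜ[k] r = (a ⊗ₜ 1) * (1 ⊗ₜ r) := by simp
    have h3 : (a ⊗ₜ[k] (1 : R)) * t = t * (a ⊗ₜ 1) := ht _ ⟨a, rfl⟩
    rw [h2, mul_assoc, h1, ← mul_assoc, h3, mul_assoc]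

theorem map_center_val_injective (A : Type*) [Ring A] [Algebra k A] :
    Function.Injective
      (Algebra.TensorProduct.map (Subalgebra.center k A).val (AlgHom.id k R)) :=
  Module.Flat.rTensor_preserves_injective_linearMap (M := R)
    (Subalgebra.center k A).val.toLinearMap Subtype.val_injective

/-- The center of `A ⊗ R` is the tensor product of the center of `A` with `R`. -/
def centerTensorEquiv (A : Type*) [Ring A] [Algebra k A] :
    Subalgebra.center k A ⊗[k] R ≃ₐ[k] Subalgebra.center k (A ⊗[k] R) :=
  (AlgEquiv.ofInjective _ (map_center_val_injective A)).trans
    (Subalgebra.equivOfEq _ _ (center_tensorProduct A).symm)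

theorem map_center_algEquiv {S T : Type*} [Ring S] [Algebra k S] [Ring T] [Algebra k T]
    (φ : S ≃ₐ[k] T) : (Subalgebra.center k S).map (φ : S →ₐ[k] T) = Subalgebra.center k T := by
  ext t
  simp only [Subalgebra.mem_map, Subalgebra.mem_center_iff]
  constructor
  · rintro ⟨s, hs, rfl⟩ b
    simpa using congrArg φ (hs (φ.symm b))
  · intro ht
    refine ⟨φ.symm t, fun b => ?_, by simp⟩
    simpa using congrArg φ.symm (ht (φ b))

/-- An isomorphism `A ⊗ R ≅ B ⊗ R` restricts to the centers. -/
def centerTensorCongr {A B : Type*} [Ring A] [Algebra k A] [Ring B] [Algebra k B]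
    (φ : A ⊗[k] R ≃ₐ[k] B ⊗[k] R) :
    Subalgebra.center k A ⊗[k] R ≃ₐ[k] Subalgebra.center k B ⊗[k] R :=
  ((centerTensorEquiv A).trans ((φ.subalgebraMap _).trans
    (Subalgebra.equivOfEq _ _ (map_center_algEquiv φ)))).trans (centerTensorEquiv B).symm

end CenterTensor

/-! ### Comparison of transcendence degrees -/

section

variable {k R : Type*} [CommRing k] [IsDomain k] [CommRing R] [IsDomain R] [Algebra k R]
  [Module.Flat k R] [Algebra.FiniteType k R]

/-- Tensoring with `R` adds the transcendence degree of `R`, which is finite and hence cancels. So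
`C` and `C'` have the same finite transcendence degree, and an independent family of that size is a
basis. -/
theorem AlgebraicIndependent.isTranscendenceBasis_of_tensor_algEquiv {C C' : Type*} [CommRing C]
    [Algebra k C] [CommRing C'] [Algebra k C'] [IsDomain (C ⊗[k] R)]
    (hkR : Function.Injective (algebraMap k R))
    (hL : Function.Injective (Algebra.TensorProduct.includeLeft : C →ₐ[k] C ⊗[k] R))
    (hL' : Function.Injective (Algebra.TensorProduct.includeLeft : C' →ₐ[k] C' ⊗[k] R))
    (e : C ⊗[k] R ≃ₐ[k] C' ⊗[k] R) {ι : Type*} [Finite ι] {c : ι → C}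
    (hc : IsTranscendenceBasis k c) {d : ι → C'} (hd : AlgebraicIndependent k d) :
    IsTranscendenceBasis k d := by
  have : IsDomain (C' ⊗[k] R) := e.symm.injective.isDomain e.symm.toAlgHom.toRingHom
  have : IsDomain C' := hL'.isDomain
    (Algebra.TensorProduct.includeLeft : C' →ₐ[k] C' ⊗[k] R).toRingHom
  have hR := Algebra.TensorProduct.includeRight_injective (B := R) hc.1.algebraMap_injective
  have hR' := Algebra.TensorProduct.includeRight_injective (B := R) hd.algebraMap_injective
  have : FaithfulSMul k R := (faithfulSMul_iff_algebraMap_injective k R).2 hkR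
  have : FaithfulSMul k C' := (faithfulSMul_iff_algebraMap_injective k C').2
    hd.algebraMap_injective
  obtain ⟨κ, r, hr⟩ := exists_isTranscendenceBasis' k R
  obtain ⟨ι', c', hc'⟩ := exists_isTranscendenceBasis' k C'
  have hκ : Finite κ := by
    rw [← Cardinal.mk_lt_aleph0_iff, hr.cardinalMk_eq_trdeg]
    exact trdeg_lt_aleph0_of_finiteType
  have h1 := e.isTranscendenceBasis (hc.sumElim_tmul hL hR hr)
  have h2 := hc'.sumElim_tmul hL' hR' hr
  obtain ⟨g⟩ := Cardinal.lift_mk_eq'.1 (h1.lift_cardinalMk_eq h2)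
  have : Finite (ι' ⊕ κ) := Finite.of_equiv _ g
  have : Finite ι' := Finite.of_injective (Sum.inl : ι' → ι' ⊕ κ) Sum.inl_injective
  have h3 : Nat.card ι = Nat.card ι' := by
    have := Nat.card_congr g
    rw [Nat.card_sum, Nat.card_sum] at this
    omega
  obtain ⟨g'⟩ := Finite.card_eq.1 h3
  exact hd.isTranscendenceBasis_of_lift_trdeg_le_of_finite
    (hc'.comp_equiv g').lift_cardinalMk_eq_trdeg.ge

end

/-- A nonzero algebraic element of a domain divides a nonzero element of the base, so a nonzero
kernel meets the base. -/
theorem exists_ne_zero_map_algebraMap_eq_zero {S B A : Type*} [CommRing S] [Ring B] [IsDomain B]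
    [Ring A] [Algebra S B] {b : B} (hb : IsAlgebraic S b) (hb0 : b ≠ 0) (β : B →+* A)
    (hβ : β b = 0) : ∃ s : S, s ≠ 0 ∧ β (algebraMap S B s) = 0 := by
  obtain ⟨s, hs, c, hc⟩ := hb.exists_nonzero_dvd (mem_nonZeroDivisors_of_ne_zero hb0)
  exact ⟨s, hs, by rw [hc, map_mul, hβ, zero_mul]⟩

theorem IsQuasiBasis.isAlgebraic {D : Type*} [Ring D] [IsDomain D] {n : ℕ} {d : Fin n → D}
    (hd : IsQuasiBasis d) (a : D) : IsAlgebraic (Subring.center D) a := by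
  have h1 := hd.not_linearIndependent (Nat.lt_succ_self n) (fun i => a ^ (i : ℕ))
  rw [Fintype.not_linearIndependent_iff] at h1
  obtain ⟨g, hg, i, hi⟩ := h1
  refine ⟨∑ j : Fin (n + 1), Polynomial.monomial (j : ℕ) (g j), fun h0 => hi ?_, ?_⟩
  · have := congrArg (fun p => Polynomial.coeff p i) h0
    simpa [Polynomial.finsetSum_coeff, Polynomial.coeff_monomial, Fin.val_inj] using this
  · rw [map_sum, ← hg]
    refine Finset.sum_congr rfl fun j _ => ?_
    rw [Polynomial.aeval_monomial, Algebra.smul_def]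

section Cancellation

variable {k A B R : Type*} [CommRing k] [CommRing R] [Algebra k R] {𝓡 : ℕ → Submodule k R}
  [GradedAlgebra 𝓡] (h𝓡 : IsConnectedGrading 𝓡) [Ring A] [Algebra k A] [Ring B] [Algebra k B]

/-- The homomorphism `A → B` that is induced by an isomorphism `A ⊗ R ≅ B ⊗ R` and the
augmentation of `R`. -/
def crossHom (φ : A ⊗[k] R ≃ₐ[k] B ⊗[k] R) : A →ₐ[k] B :=
  (tensorAug h𝓡 B).comp ((φ : A ⊗[k] R →ₐ[k] B ⊗[k] R).comp Algebra.TensorProduct.includeLeft)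

theorem crossHom_apply (φ : A ⊗[k] R ≃ₐ[k] B ⊗[k] R) (a : A) :
    crossHom h𝓡 φ a = tensorAug h𝓡 B (φ (a ⊗ₜ 1)) := rfl

/-- Surjectivity of `crossHom` is not needed: each `b` is the augmentation of `φ t` with `t = φ.symm
(b ⊗ₜ 1)`, and `a ⊗ₜ 1` commutes with `t`. -/
theorem crossHom_mem_center (φ : A ⊗[k] R ≃ₐ[k] B ⊗[k] R) {a : A}
    (ha : a ∈ Subalgebra.center k A) : crossHom h𝓡 φ a ∈ Subalgebra.center k B := by
  rw [Subalgebra.mem_center_iff] at ha ⊢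
  have h1 : ∀ t : A ⊗[k] R, t * (a ⊗ₜ 1) = (a ⊗ₜ 1) * t := by
    intro t
    induction t using TensorProduct.induction_on with
    | zero => simp
    | add x y hx hy => rw [add_mul, mul_add, hx, hy]
    | tmul a' r => simp [ha]
  intro b
  have h2 := congrArg (fun t => tensorAug h𝓡 B (φ t)) (h1 (φ.symm (b ⊗ₜ 1)))
  simpa [tensorAug_includeLeft, crossHom_apply] using h2

/-- Dilating `φ (a ⊗ₜ 1)` and mapping its coefficients back to `A` gives a polynomial with value `a`
at `X = 1` and the double `crossHom` at `X = 0`. It is constant for `a = f`, because `φ` sends `f`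
into `B`, and hence for all `a` by effectiveness. -/
theorem crossHom_crossHom_of_effective {k : Type u₁} {A : Type u₂} {B R : Type*} [CommRing k]
    [CommRing R] [Algebra k R] {𝓡 : ℕ → Submodule k R}
    [GradedAlgebra 𝓡] (h𝓡 : IsConnectedGrading 𝓡) [Ring A] [Algebra k A] [Ring B] [Algebra k B]
    [IsDomain A] {w : ℕ} {f : A} (hf : DividesTraceDets w f) (hf0 : f ≠ 0)
    (heff : IsEffective k f) (φ : A ⊗[k] R ≃ₐ[k] B ⊗[k] R) {b : B} (hb : φ (f ⊗ₜ 1) = b ⊗ₜ 1)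
    (a : A) : crossHom h𝓡 φ.symm (crossHom h𝓡 φ a) = a := by
  let χ : B ⊗[k] R →ₐ[k] A := (tensorAug h𝓡 A).comp (φ.symm : B ⊗[k] R →ₐ[k] A ⊗[k] R)
  let Ψ : A →ₐ[k] A[X] := (Polynomial.mapAlgHom χ).comp ((tensorGradingHom 𝓡 B).comp
    ((φ : A ⊗[k] R →ₐ[k] B ⊗[k] R).comp Algebra.TensorProduct.includeLeft))
  have hΨ : ∀ a, Ψ a = (tensorGradingHom 𝓡 B (φ (a ⊗ₜ 1))).map (χ : B ⊗[k] R →+* A) :=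
    fun a => rfl
  have hχ : ∀ a, χ (φ (a ⊗ₜ 1)) = a := fun a => by simp [χ, tensorAug_includeLeft]
  have hPI : IsPI k A[X] := by
    obtain ⟨n, d, hd⟩ := (hf.map (Polynomial.isFreeCentralExt A)).exists_isQuasiBasis
    exact hd.isPI
  have h1 := heff.eq_C (P := A) (j := AlgHom.id k A) (Ψ := Ψ) (θ := 1) hf0 hPI
    (fun _ _ h => h) (fun F hF => ⟨F, hF, fun _ => rfl⟩) (fun a => by
      rw [map_one, hΨ, Polynomial.eval_one_map, eval_one_tensorGradingHom]
      exact hχ a) (by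
      rw [hΨ, hb, tensorGradingHom_includeLeft, Polynomial.map_C, ← hb]
      exact congrArg Polynomial.C (hχ f)) a
  have h2 := congrArg (fun p => Polynomial.coeff p 0) h1
  simp only [hΨ, Polynomial.coeff_map, coeff_zero_tensorGradingHom h𝓡,
    Polynomial.coeff_C_zero] at h2
  exact h2

theorem exists_map_tmul_one_eq [IsDomain A] [IsDomain (A ⊗[k] R)] [IsDomain (B ⊗[k] R)]
    [IsDomain B] [Module.Free k R] {w : ℕ} {f : A} (hf : DividesTraceDets w f)
    (φ : A ⊗[k] R ≃ₐ[k] B ⊗[k] R) (h𝓡 : IsConnectedGrading 𝓡) :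
    (∃ b : B, φ (f ⊗ₜ 1) = b ⊗ₜ 1) ∧ ∃ (n : ℕ) (d : Fin n → B), IsQuasiBasis d := by
  have hA := TensorProduct.isFreeCentralExt (Module.Free.chooseBasis k R)
    (includeLeft_injective_of_connected h𝓡 A)
  have hB := TensorProduct.isFreeCentralExt (Module.Free.chooseBasis k R)
    (includeLeft_injective_of_connected h𝓡 B)
  have h1 := (hf.map hA).map (IsFreeCentralExt.of_ringEquiv φ.toRingEquiv)
  constructor
  · obtain ⟨b, hb⟩ := h1.mem_range hB (mem_range_includeLeft_of_mul h𝓡 B)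
    exact ⟨b, hb.symm⟩
  · obtain ⟨n, d, hd⟩ := h1.exists_isQuasiBasis
    exact exists_isQuasiBasis_of_bounded (n := n) fun v hv =>
      hd.not_linearIndependent (Nat.lt_succ_self n) _ (hB.linearIndependent hv)

/-- Since `β ∘ α = id`, only injectivity of `β` remains. A nonzero kernel would descend along two
algebraic extensions, first to the center of `B`, then to the subalgebra generated by the image of a
transcendence basis under `α`, where `β` inverts `α`. -/
theorem nonempty_algEquiv_of_tensor {k : Type u₁} {A : Type u₂} {B R : Type*} [CommRing k]
    [IsDomain k] [CommRing R] [IsDomain R] [Algebra k R] [Algebra.FiniteType k R]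
    [Module.Free k R] {𝓡 : ℕ → Submodule k R} [GradedAlgebra 𝓡] (h𝓡 : IsConnectedGrading 𝓡)
    [Ring A] [Algebra k A] [Ring B] [Algebra k B] [IsDomain A] [IsDomain (A ⊗[k] R)] {w : ℕ}
    {f : A} (hf : DividesTraceDets w f) (hf0 : f ≠ 0) (heff : IsEffective k f)
    (hgk : gkDim k A < ⊤) (φ : A ⊗[k] R ≃ₐ[k] B ⊗[k] R) : Nonempty (A ≃ₐ[k] B) := by
  have : IsDomain (B ⊗[k] R) := φ.symm.injective.isDomain φ.symm.toAlgHom.toRingHom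
  have : IsDomain B := (includeLeft_injective_of_connected h𝓡 B).isDomain
    (Algebra.TensorProduct.includeLeft : B →ₐ[k] B ⊗[k] R).toRingHom
  obtain ⟨⟨b₀, hb₀⟩, n, d, hd⟩ := exists_map_tmul_one_eq hf φ h𝓡
  let α : A →ₐ[k] B := crossHom h𝓡 φ
  let β : B →ₐ[k] A := crossHom h𝓡 φ.symm
  have hβα : ∀ a, β (α a) = a := crossHom_crossHom_of_effective h𝓡 hf hf0 heff φ hb₀
  let C := Subalgebra.center k A
  let C' := Subalgebra.center k B
  let αC : C →ₐ[k] C' := (α.comp C.val).codRestrict C' fun c => crossHom_mem_center h𝓡 φ c.2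
  let βC : C' →ₐ[k] C := (β.comp C'.val).codRestrict C fun c =>
    crossHom_mem_center h𝓡 φ.symm c.2
  have hβαC : ∀ c, βC (αC c) = c := fun c => Subtype.ext (hβα c)
  have hkA : Function.Injective (algebraMap k A) := by
    obtain ⟨n, x, hx, -⟩ := heff
    exact hx.injective
  have hkC : Function.Injective (algebraMap k C) := fun x y h => hkA (congrArg Subtype.val h)
  have : FaithfulSMul k C := (faithfulSMul_iff_algebraMap_injective k C).2 hkC
  have : IsDomain (C ⊗[k] R) := (map_center_val_injective (R := R) A).isDomain
    (Algebra.TensorProduct.map C.val (AlgHom.id k R)).toRingHom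
  obtain ⟨ι, c, hc⟩ := exists_isTranscendenceBasis' k C
  have : Finite ι := finite_of_gkDim_lt_top hgk hc.1
  have hαc : AlgebraicIndependent k (αC ∘ c) := by
    refine AlgebraicIndependent.of_comp βC ?_
    have : βC ∘ αC ∘ c = c := funext fun i => hβαC (c i)
    rw [this]
    exact hc.1
  -- The isomorphism restricts to the centers, so independence of the `α`-images upgrades to a
  -- transcendence basis.
  have hαcT := hαc.isTranscendenceBasis_of_tensor_algEquiv h𝓡.1
    (includeLeft_injective_of_connected h𝓡 C) (includeLeft_injective_of_connected h𝓡 C')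
    (centerTensorCongr φ) hc
  have hβ : Function.Injective β := by
    rw [injective_iff_map_eq_zero]
    intro b hb
    by_contra hb0
    obtain ⟨c₀, hc₀, hβc₀⟩ := exists_ne_zero_map_algebraMap_eq_zero (hd.isAlgebraic b) hb0
      (β : B →+* A) hb
    let c₁ : C' := ⟨c₀, Subalgebra.mem_center_iff.2 (Subring.mem_center_iff.1 c₀.2)⟩
    have hc₁ : c₁ ≠ 0 := fun h => hc₀ (Subtype.ext (congrArg Subtype.val h))
    obtain ⟨s, hs, hβs⟩ := exists_ne_zero_map_algebraMap_eq_zero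
      (hαcT.isAlgebraic.isAlgebraic c₁) hc₁ (βC : C' →+* C) (Subtype.ext hβc₀)
    have hle : Algebra.adjoin k (Set.range (αC ∘ c)) ≤ αC.range := by
      rw [Algebra.adjoin_le_iff]
      rintro _ ⟨i, rfl⟩
      exact ⟨c i, rfl⟩
    obtain ⟨a, ha⟩ := hle s.2
    have h1 : βC s = 0 := hβs
    have h2 : βC s = a := by
      rw [← ha]
      exact hβαC a
    apply hs
    apply Subtype.ext
    rw [← ha, ← h2, h1]
    exact map_zero αC
  exact ⟨(AlgEquiv.ofBijective β ⟨hβ, fun a => ⟨α a, hβα a⟩⟩).symm⟩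

end Cancellation

/-! ### Polynomial rings as tensor products -/

section PolyRing

variable (k A : Type*) [CommRing k] [Ring A] [Algebra k A] (d : ℕ)

/-- The `k`-algebra homomorphism `A → A[t_1, …, t_d]`. -/
def polyRingC : A →ₐ[k] PolyRing A d :=
  { (AddMonoidAlgebra.singleZeroRingHom : A →+* PolyRing A d) with commutes' := fun _ => rfl }

/-- The `k`-algebra homomorphism `k[t_1, …, t_d] → A[t_1, …, t_d]`. -/
def mvPolynomialToPolyRing : MvPolynomial (Fin d) k →ₐ[k] PolyRing A d :=
  AddMonoidAlgebra.mapAlgHom (Fin d →₀ ℕ) (Algebra.ofId k A)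

theorem mvPolynomialToPolyRing_monomial (m : Fin d →₀ ℕ) (c : k) :
    mvPolynomialToPolyRing k A d (MvPolynomial.monomial m c) =
      AddMonoidAlgebra.single m (algebraMap k A c) := by
  rw [mvPolynomialToPolyRing]
  exact AddMonoidAlgebra.map_single _ _ _

theorem commute_polyRingC (a : A) (p : MvPolynomial (Fin d) k) :
    Commute (polyRingC k A d a) (mvPolynomialToPolyRing k A d p) := by
  induction p using MvPolynomial.induction_on' with
  | monomial m c =>
    rw [mvPolynomialToPolyRing_monomial]
    change AddMonoidAlgebra.single 0 a * _ = _ * AddMonoidAlgebra.single 0 a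
    rw [AddMonoidAlgebra.single_mul_single, AddMonoidAlgebra.single_mul_single, zero_add, add_zero,
      Algebra.commutes]
  | add p q hp hq => rw [map_add]; exact hp.add_right hq

/-- The homomorphism `A ⊗ k[t_1, …, t_d] → A[t_1, …, t_d]`. -/
def tensorToPolyRing : A ⊗[k] MvPolynomial (Fin d) k →ₐ[k] PolyRing A d :=
  Algebra.TensorProduct.lift (polyRingC k A d) (mvPolynomialToPolyRing k A d)
    (commute_polyRingC k A d)

/-- The coefficients of the image are the coordinates in the monomial basis of the free left
`A`-module; bijectivity follows. -/
theorem tensorToPolyRing_coeff (t : A ⊗[k] MvPolynomial (Fin d) k) :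
    (tensorToPolyRing k A d t).coeff =
      (Algebra.TensorProduct.basis A (MvPolynomial.basisMonomials (Fin d) k)).repr t := by
  induction t using TensorProduct.induction_on with
  | zero => simp
  | add x y hx hy => rw [map_add, map_add, ← hx, ← hy]; rfl
  | tmul a p =>
    induction p using MvPolynomial.induction_on' with
    | add p q hp hq => rw [TensorProduct.tmul_add, map_add, map_add, ← hp, ← hq]; rfl
    | monomial m c =>
      rw [tensorToPolyRing, Algebra.TensorProduct.lift_tmul, mvPolynomialToPolyRing_monomial]
      have h1 : polyRingC k A d a = AddMonoidAlgebra.single 0 a := rfl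
      rw [h1, AddMonoidAlgebra.single_mul_single, zero_add]
      ext m'
      rw [Algebra.TensorProduct.basis_repr_tmul]
      rw [show (MvPolynomial.basisMonomials (Fin d) k).repr (MvPolynomial.monomial m c) =
        Finsupp.single m c from rfl]
      by_cases h : m = m'
      · subst h
        simp
      · simp [h]


theorem tensorToPolyRing_bijective : Function.Bijective (tensorToPolyRing k A d) := by
  have h1 : ⇑(tensorToPolyRing k A d) = (fun c => (AddMonoidAlgebra.ofCoeff c : PolyRing A d)) ∘
      (Algebra.TensorProduct.basis A (MvPolynomial.basisMonomials (Fin d) k)).repr :=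
    funext fun t => by rw [Function.comp_apply, ← tensorToPolyRing_coeff]
  rw [h1]
  exact AddMonoidAlgebra.coeffEquiv.symm.bijective.comp (LinearEquiv.bijective _)

/-- `A ⊗ k[t_1, …, t_d] ≅ A[t_1, …, t_d]`. -/
def tensorEquivPolyRing : A ⊗[k] MvPolynomial (Fin d) k ≃ₐ[k] PolyRing A d :=
  AlgEquiv.ofBijective _ (tensorToPolyRing_bijective k A d)

end PolyRing

theorem isConnectedGrading_homogeneousSubmodule (σ k : Type*) [CommRing k] :
    IsConnectedGrading (MvPolynomial.homogeneousSubmodule σ k) :=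
  ⟨MvPolynomial.C_injective σ k, MvPolynomial.homogeneousSubmodule_zero σ⟩

/-- The case `R = k[t₁, …, t_d]`, graded by total degree. -/
theorem isStronglyCancellative_of_dividesTraceDets {k : Type u₁} {A : Type u₂} [CommRing k]
    [IsDomain k] [Ring A] [IsDomain A] [Algebra k A] {w : ℕ} {f : A}
    (hf : DividesTraceDets w f) (hf0 : f ≠ 0) (heff : IsEffective k f) (hgk : gkDim k A < ⊤) :
    IsStronglyCancellative.{u₁, u₂, u₄} k A := by
  rintro d - B _ _ ⟨φ⟩
  have : IsDomain (A ⊗[k] MvPolynomial (Fin d) k) :=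
    (tensorEquivPolyRing k A d).injective.isDomain (tensorEquivPolyRing k A d).toAlgHom.toRingHom
  have : GradedAlgebra (MvPolynomial.homogeneousSubmodule (Fin d) k) := MvPolynomial.gradedAlgebra
  exact nonempty_algEquiv_of_tensor (isConnectedGrading_homogeneousSubmodule (Fin d) k) hf hf0 heff
    hgk (((tensorEquivPolyRing k A d).trans φ).trans (tensorEquivPolyRing k B d).symm)

theorem theorem5p2 {k : Type u₁} {A : Type u₂} [CommRing k] [IsDomain k]
    [Ring A] [IsDomain A] [Algebra k A] (hPI : IsPI k A)
    (w : ℕ) (hw : 1 ≤ w) (f : A) (hf : IsDiscriminant w f) (hf0 : f ≠ 0) :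
    (IsEffective k f → gkDim k A < ⊤ →
      (∀ (R : Type u₃) [CommRing R] [IsDomain R] [Algebra k R] [Algebra.FiniteType k R]
          [Module.Free k R] (𝓡 : ℕ → Submodule k R) [GradedAlgebra 𝓡],
          IsConnectedGrading 𝓡 → IsDomain (A ⊗[k] R) →
          ∀ (B : Type u₄) [Ring B] [Algebra k B],
            Nonempty (A ⊗[k] R ≃ₐ[k] B ⊗[k] R) → Nonempty (A ≃ₐ[k] B)) ∧
      IsStronglyCancellative.{u₁, u₂, u₄} k A) ∧
    (IsEffective k f ∨ IsDominating k f → IsStronglyLNDHRigid k A) := by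
  have hD := hf.dividesTraceDets hw hf0
  refine ⟨fun heff hgk => ⟨?_, isStronglyCancellative_of_dividesTraceDets hD hf0 heff hgk⟩,
    isStronglyLNDHRigid_of_dividesTraceDets hD hf0⟩
  rintro R _ _ _ _ _ 𝓡 _ h𝓡 _ B _ _ ⟨φ⟩
  exact nonempty_algEquiv_of_tensor h𝓡 hD hf0 heff hgk φ
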